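/- **Setting.** Let $\mathcal D$ be a dyadic grid on $\mathbb R^d$, $d\ge 1$: the cubes have side lengths $\ell(Q)=u\,2^k$, $k\in\mathbb Z$ ($u>0$ fixed), the cubes of each side length partition $\mathbb R^d$, and each cube $Q$ is the union of $2^d$ cubes of side length $\ell(Q)/2$, its children. A generalized Haar function on $Q$ is a linear combination of the indicators of the children of $Q$. A generalized Haar shift of complexity type $(m,n)$, $m,n\in\{0,1,2,\dots\}$, is an operator $$\mathbb S f=\sum_{Q\in\mathcal D}\mathbb S_Q f,\qquad \mathbb S_Q f(x)=\sum_{\substack{Q',R'\subset Q\\ \ell(Q')=2^{-m}\ell(Q),\ \ell(R')=2^{-n}\ell(Q)}}\frac{\langle f,h^{Q'}_{R'}\rangle}{|Q|}\,k^{R'}_{Q'}(x),$$ where $Q',R'\in\mathcal D$, $\langle f,h\rangle=\int fh$, and $h^{Q'}_{R'}$, $k^{R'}_{Q'}$ are generalized (complex) Haar functions on $R'$ and $Q'$ respectively, bounded by $1$ in absolute value. (Haar shifts, where all these functions also have integral zero, paraproducts and dual paraproducts are special cases.) Its complexity is $\kappa=\max(m,n,1)$, and $s_Q(x,y)=\sum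 h^{Q'}_{R'}(y)\,k^{R'}_{Q'}(x)$ is the kernel of $\mathbb S_Q$, that is, $\mathbb S_Qf(x)=|Q|^{-1}\int_Q s_Q(x,y)f(y)\,dy$. It is $L^2$-bounded if the series $\sum_Q\mathbb S_Q$, summed over the scales $2^{-N}\le\ell(Q)\le 2^N$ with $N\to\infty$, converges in the weak operator topology of $L^2(\mathbb R^d)$ to a bounded operator, whose norm is denoted $\|\mathbb S\|$. It has separated scales if $\log_2\ell(Q)\equiv\log_2\ell(Q')\pmod{\kappa+1}$ whenever $\mathbb S_Q\ne0$ and $\mathbb S_{Q'}\neq 0$. A linearization $\mathbb L$ of the maximal truncations $\mathbb S_\natural f=\sup_{0<\epsilon\le\upsilon<\infty}\bigl|\sum_{\epsilon\le\ell(Q)\le\upsilon}\mathbb S_Qf\bigr|$ is an operator $$\mathbb Lf(x)=e^{i\vartheta(x)}\sum_{\epsilon(x)\le\ell(Q)\le\upsilon(x)}\mathbb S_Qf(x)$$ with measurable $\epsilon,\upsilon:\mathbb R^d\to(0,\infty)$ and $\vartheta:\mathbb R^d\to[0,2\pi)$. Its adjoint is given by $$\mathbb L^*f(y)=\sum_{Q\in\mathcal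 D}\frac1{|Q|}\int_Q s_Q(x,y)\,\mathbf 1_{\{\epsilon(x)\le\ell(Q)\le\upsilon(x)\}}\,e^{i\vartheta(x)}f(x)\,dx,$$ where the sum is the limit as $N\to\infty$ of the sums over $2^{-N}\le\ell(Q)\le2^N$. **Theorem.** For every $d\ge1$ there is a constant $C_d$ such that for every $L^2$-bounded generalized Haar shift $\mathbb S$ of complexity $\kappa$, every linearization $\mathbb L$ of $\mathbb S_\natural$, and every bounded, compactly supported (measurable) $f:\mathbb R^d\to\mathbb C$, the series defining $\mathbb L^*f$ converges almost everywhere, and $$\lambda\,|\{|\mathbb L^*f|>\lambda\}|\le C_d\,\max(1,\|\mathbb S\|)\,\kappa\,\|f\|_1\qquad\text{for all }\lambda>0.$$ If $\mathbb S$ has separated scales, then moreover $$\lambda\,|\{|\mathbb L^*f|>\lambda\}|\le C_d\,\max(1,\|\mathbb S\|)\,\|f\|_1\qquad\text{for all }\lambda>0.$$ -/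

import Mathlib

open MeasureTheory Filter Topology

noncomputable section

namespace HaarModel

/-- The half-open axis-parallel cube in `ℝ^d` with lower corner `a` and side length `s`. -/
def box {d : ℕ} (a : Fin d → ℝ) (s : ℝ) : Set (Fin d → ℝ) :=
  {x | ∀ i, a i ≤ x i ∧ x i < a i + s}

/-- A dyadic grid on `ℝ^d`. The cubes of level `k : ℤ` have side length `unit * 2 ^ k`, and
`corners k` is the set of their lower corners. The cubes of one level partition `ℝ^d`, and each
cube is the union of `2 ^ d` cubes of the next smaller level (its children). No translation
structure is imposed; the standard grid is the case `unit = 1`, `corners k = 2 ^ k ℤ^d`. -/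
structure DyadicGrid (d : ℕ) where
  unit : ℝ
  unit_pos : 0 < unit
  corners : ℤ → Set (Fin d → ℝ)
  partition : ∀ (k : ℤ) (x : Fin d → ℝ), ∃! a, a ∈ corners k ∧ x ∈ box a (unit * 2 ^ k)
  children : ∀ (k : ℤ), ∀ a ∈ corners k, ∃ s : Finset (Fin d → ℝ),
    s.card = 2 ^ d ∧ (∀ b ∈ s, b ∈ corners (k - 1)) ∧
      box a (unit * 2 ^ k) = ⋃ b ∈ s, box b (unit * 2 ^ (k - 1))

/-- The cubes of a dyadic grid. -/
structure DyadicGrid.Cube {d : ℕ} (D : DyadicGrid d) where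
  level : ℤ
  corner : Fin d → ℝ
  corner_mem : corner ∈ D.corners level

namespace DyadicGrid.Cube

variable {d : ℕ} {D : DyadicGrid d}

/-- The side length `ℓ(Q)`. -/
def side (Q : D.Cube) : ℝ := D.unit * 2 ^ Q.level

/-- The cube as a subset of `ℝ^d`. -/
def toSet (Q : D.Cube) : Set (Fin d → ℝ) := box Q.corner Q.side

/-- The Lebesgue measure `|Q|`. -/
def vol (Q : D.Cube) : ℝ := volume.real Q.toSet

theorem side_pos (Q : D.Cube) : 0 < Q.side :=
  mul_pos D.unit_pos (zpow_pos (by norm_num) _)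

theorem vol_eq (Q : D.Cube) : Q.vol = Q.side ^ d := by
  have h : Q.toSet = Set.univ.pi fun i => Set.Ico (Q.corner i) (Q.corner i + Q.side) := by
    ext x
    simp [toSet, box]
  rw [vol, h, measureReal_def, Real.volume_pi_Ico]
  simp [ENNReal.toReal_ofReal Q.side_pos.le]

theorem exists_descendants (Q : D.Cube) (m : ℕ) : ∃ s : Finset (Fin d → ℝ),
    (∀ b ∈ s, b ∈ D.corners (Q.level - m)) ∧
      Q.toSet = ⋃ b ∈ s, box b (D.unit * 2 ^ (Q.level - m)) := by
  classical
  induction m with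
  | zero => exact ⟨{Q.corner}, by simpa using Q.corner_mem, by simp [toSet, side]⟩
  | succ m ih =>
    obtain ⟨s, hs, hQ⟩ := ih
    choose! t _ ht2 ht3 using fun b (hb : b ∈ s) => D.children _ b (hs b hb)
    have e : Q.level - ((m + 1 : ℕ) : ℤ) = Q.level - m - 1 := by push_cast; ring
    rw [e]
    refine ⟨s.biUnion t, ?_, ?_⟩
    · intro b hb
      obtain ⟨c, hc, hb⟩ := Finset.mem_biUnion.1 hb
      exact ht2 c hc b hb
    · rw [hQ, Finset.set_biUnion_biUnion]
      exact Set.iUnion₂_congr ht3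

theorem finite_descendants (Q : D.Cube) (m : ℕ) :
    {P : D.Cube | P.level = Q.level - m ∧ P.toSet ⊆ Q.toSet}.Finite := by
  obtain ⟨s, hs, hQ⟩ := Q.exists_descendants m
  refine Set.Finite.of_finite_image (f := corner) (s.finite_toSet.subset ?_) ?_
  · rintro _ ⟨P, ⟨hl, hP⟩, rfl⟩
    have hmem : P.corner ∈ P.toSet := fun i => ⟨le_rfl, by linarith [P.side_pos]⟩
    have h1 := hP hmem
    rw [hQ] at h1
    obtain ⟨b, hb, hPb⟩ := Set.mem_iUnion₂.1 h1
    have h2 : P.corner = b := (D.partition (Q.level - m) P.corner).unique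
      ⟨hl ▸ P.corner_mem, by rw [← hl]; exact hmem⟩ ⟨hs b hb, hPb⟩
    rw [h2]
    exact hb
  · rintro ⟨l, a, ha⟩ ⟨h1, -⟩ ⟨l', a', ha'⟩ ⟨h2, -⟩ h3
    simp only at h1 h2 h3
    subst h1 h2 h3
    rfl

/-- The finitely many cubes `P ⊆ Q` of the grid with `ℓ(P) = 2^{-m} ℓ(Q)`. -/
def descendants (Q : D.Cube) (m : ℕ) : Finset D.Cube := (Q.finite_descendants m).toFinset

theorem mem_descendants {Q P : D.Cube} {m : ℕ} :
    P ∈ Q.descendants m ↔ P.level = Q.level - m ∧ P.toSet ⊆ Q.toSet := by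
  simp [descendants]

/-- `h` is a generalized Haar function on `Q`: a linear combination of the indicators of the
children of `Q`. -/
def IsGenHaar (Q : D.Cube) (h : (Fin d → ℝ) → ℂ) : Prop :=
  ∃ c : D.Cube → ℂ, h = fun x => ∑ P ∈ Q.descendants 1, c P * P.toSet.indicator 1 x

end DyadicGrid.Cube

/-- A generalized Haar shift of complexity type `(m, n)`. The function `h Q' R'` lives on `R'` and
`k R' Q'` lives on `Q'`; only the pairs for which `Q'` is an `m`-th and `R'` an `n`-th generation
descendant of a common cube `Q` matter. The Haar shifts proper are the special case in which all
these functions have integral zero, and the paraproducts and dual paraproducts are special cases of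
type `(0, 0)`. -/
structure HaarShift {d : ℕ} (D : DyadicGrid d) (m n : ℕ) where
  h : D.Cube → D.Cube → (Fin d → ℝ) → ℂ
  k : D.Cube → D.Cube → (Fin d → ℝ) → ℂ
  h_haar : ∀ Q : D.Cube, ∀ Q' ∈ Q.descendants m, ∀ R' ∈ Q.descendants n, R'.IsGenHaar (h Q' R')
  k_haar : ∀ Q : D.Cube, ∀ Q' ∈ Q.descendants m, ∀ R' ∈ Q.descendants n, Q'.IsGenHaar (k R' Q')
  h_le : ∀ Q : D.Cube, ∀ Q' ∈ Q.descendants m, ∀ R' ∈ Q.descendants n, ∀ x, ‖h Q' R' x‖ ≤ 1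
  k_le : ∀ Q : D.Cube, ∀ Q' ∈ Q.descendants m, ∀ R' ∈ Q.descendants n, ∀ x, ‖k R' Q' x‖ ≤ 1

namespace HaarShift

variable {d : ℕ} {D : DyadicGrid d} {m n : ℕ}

/-- The complexity `κ = max (m, n, 1)`. -/
def complexity (_S : HaarShift D m n) : ℕ := max (max m n) 1

/-- The component `S_Q`. The pairing is bilinear; this is immaterial, as the `h Q' R'` may be
replaced by their complex conjugates. -/
def comp (S : HaarShift D m n) (Q : D.Cube) (f : (Fin d → ℝ) → ℂ) (x : Fin d → ℝ) : ℂ :=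
  ∑ Q' ∈ Q.descendants m, ∑ R' ∈ Q.descendants n,
    (∫ y, f y * S.h Q' R' y) / (Q.vol : ℂ) * S.k R' Q' x

/-- The kernel `s_Q(x, y)` of `S_Q`, so that `S_Q f(x) = |Q|⁻¹ ∫_Q s_Q(x, y) f(y) dy`. -/
def kernel (S : HaarShift D m n) (Q : D.Cube) (x y : Fin d → ℝ) : ℂ :=
  ∑ Q' ∈ Q.descendants m, ∑ R' ∈ Q.descendants n, S.h Q' R' y * S.k R' Q' x

/-- The transpose `S_Q^*` of `S_Q`. -/
def compAdjoint (S : HaarShift D m n) (Q : D.Cube) (g : (Fin d → ℝ) → ℂ) (y : Fin d → ℝ) : ℂ :=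
  (∫ x in Q.toSet, S.kernel Q x y * g x) / (Q.vol : ℂ)

/-- The truncation `S_{ε,υ} f(x)`, the sum of `S_Q f(x)` over the cubes with `ε ≤ ℓ(Q) ≤ υ`. For
`ε > 0` only finitely many of these cubes contain `x`, so only finitely many terms are nonzero. -/
def trunc (S : HaarShift D m n) (ε υ : ℝ) (f : (Fin d → ℝ) → ℂ) (x : Fin d → ℝ) : ℂ :=
  ∑ᶠ (Q : D.Cube) (_ : ε ≤ Q.side ∧ Q.side ≤ υ), S.comp Q f x

/-- `S` is bounded on `L²`, with `T` as the bounded operator that it defines: the series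
`∑_Q S_Q`, summed over scales, converges to `T` in the weak operator topology of `L²`. -/
def DefinesL2Operator (S : HaarShift D m n)
    (T : Lp ℂ 2 (volume : Measure (Fin d → ℝ)) →L[ℂ] Lp ℂ 2 (volume : Measure (Fin d → ℝ))) :
    Prop :=
  ∀ f g : Lp ℂ 2 (volume : Measure (Fin d → ℝ)),
    Tendsto (fun N : ℕ => ∫ x, S.trunc ((2 ^ N)⁻¹) (2 ^ N) f x * g x) atTop
      (𝓝 (∫ x, T f x * g x))

/-- `S` has its scales separated: the nonzero components `S_Q` live on scales that are congruent
modulo `κ + 1`. (The difference of the levels of two cubes is that of `log₂ ℓ`.) -/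
def ScalesSeparated (S : HaarShift D m n) : Prop :=
  ∀ Q Q' : D.Cube, S.comp Q ≠ 0 → S.comp Q' ≠ 0 →
    Q.level ≡ Q'.level [ZMOD ((S.complexity : ℤ) + 1)]

end HaarShift

/-- The parameters of a linearization of the maximal truncations of a Haar shift. -/
structure Linearization (d : ℕ) where
  eps : (Fin d → ℝ) → ℝ
  ups : (Fin d → ℝ) → ℝ
  theta : (Fin d → ℝ) → ℝ
  measurable_eps : Measurable eps
  measurable_ups : Measurable ups
  measurable_theta : Measurable theta
  eps_pos : ∀ x, 0 < eps x
  ups_pos : ∀ x, 0 < ups x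
  theta_mem : ∀ x, theta x ∈ Set.Ico 0 (2 * Real.pi)

namespace Linearization

variable {d : ℕ} {D : DyadicGrid d} {m n : ℕ}

/-- The linear operator `L f(x) = e^{iϑ(x)} S_{ε(x),υ(x)} f(x)`. -/
def op (L : Linearization d) (S : HaarShift D m n) (f : (Fin d → ℝ) → ℂ) (x : Fin d → ℝ) : ℂ :=
  Complex.exp (Complex.I * L.theta x) * S.trunc (L.eps x) (L.ups x) f x

/-- The function `1_{ε(x) ≤ ℓ(Q) ≤ υ(x)} e^{iϑ(x)} g(x)`. -/
def cut (L : Linearization d) (Q : D.Cube) (g : (Fin d → ℝ) → ℂ) : (Fin d → ℝ) → ℂ :=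
  {x | L.eps x ≤ Q.side ∧ Q.side ≤ L.ups x}.indicator
    fun x => Complex.exp (Complex.I * L.theta x) * g x

/-- The partial sum over `2^{-N} ≤ ℓ(Q) ≤ 2^N` of the series that defines `L^* g(y)`; only
finitely many of its terms are nonzero, as these cubes have to contain `y`. -/
def adjointPartial (L : Linearization d) (S : HaarShift D m n) (N : ℕ)
    (g : (Fin d → ℝ) → ℂ) (y : Fin d → ℝ) : ℂ :=
  ∑ᶠ (Q : D.Cube) (_ : ((2 : ℝ) ^ N)⁻¹ ≤ Q.side ∧ Q.side ≤ 2 ^ N),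
    S.compAdjoint Q (L.cut Q g) y

/-- The adjoint `L^* g = ∑_Q S_Q^* (1_{ε ≤ ℓ(Q) ≤ υ} e^{iϑ} g)`, summed over scales. -/
def adjoint (L : Linearization d) (S : HaarShift D m n)
    (g : (Fin d → ℝ) → ℂ) (y : Fin d → ℝ) : ℂ :=
  limUnder atTop fun N : ℕ => L.adjointPartial S N g y

end Linearization

end HaarModel

end

open scoped ENNReal

namespace HaarModel

namespace DyadicGrid

variable {d : ℕ} (D : DyadicGrid d)

/-- The cube of level `k` that contains `x`. -/
noncomputable def cell (k : ℤ) (x : Fin d → ℝ) : D.Cube :=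
  ⟨k, (D.partition k x).exists.choose, (D.partition k x).exists.choose_spec.1⟩

@[simp] theorem cell_level (k : ℤ) (x : Fin d → ℝ) : (D.cell k x).level = k := rfl

theorem mem_cell (k : ℤ) (x : Fin d → ℝ) : x ∈ (D.cell k x).toSet :=
  (D.partition k x).exists.choose_spec.2

variable {D} in
theorem eq_cell_of_mem {Q : D.Cube} {x : Fin d → ℝ} (h : x ∈ Q.toSet) :
    Q = D.cell Q.level x := by
  obtain ⟨l, a, ha⟩ := Q
  have := (D.partition l x).unique ⟨ha, h⟩ (D.partition l x).exists.choose_spec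
  simp only [cell, Cube.mk.injEq, true_and]
  exact this

theorem mem_cell_iff {k : ℤ} {x y : Fin d → ℝ} :
    y ∈ (D.cell k x).toSet ↔ D.cell k y = D.cell k x :=
  ⟨fun h => (eq_cell_of_mem h).symm, fun h => h ▸ D.mem_cell k y⟩

theorem cell_subset {k l : ℤ} (h : k ≤ l) (x : Fin d → ℝ) :
    (D.cell k x).toSet ⊆ (D.cell l x).toSet := by
  obtain ⟨s, hs, hQ⟩ := (D.cell l x).exists_descendants (l - k).toNat
  have e : (D.cell l x).level - ((l - k).toNat : ℤ) = k := by simp; omega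
  rw [e] at hs hQ
  have hx := D.mem_cell l x
  rw [hQ] at hx ⊢
  obtain ⟨b, hb, hx⟩ := Set.mem_iUnion₂.1 hx
  have : (⟨k, b, hs b hb⟩ : D.Cube) = D.cell k x :=
    eq_cell_of_mem (Q := ⟨k, b, hs b hb⟩) hx
  rw [← this]
  exact Set.subset_biUnion_of_mem (u := fun b => box b (D.unit * 2 ^ k)) hb

theorem cell_eq_of_le {k l : ℤ} (h : k ≤ l) {x y : Fin d → ℝ} (e : D.cell k x = D.cell k y) :
    D.cell l x = D.cell l y :=
  D.mem_cell_iff.1 (D.cell_subset h y (D.mem_cell_iff.2 e))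

theorem cell_mem_descendants (k : ℤ) (m : ℕ) (x : Fin d → ℝ) :
    D.cell (k - m) x ∈ (D.cell k x).descendants m :=
  Cube.mem_descendants.2 ⟨rfl, D.cell_subset (by omega) x⟩

variable {D} in
theorem eq_of_mem_descendants {Q P : D.Cube} {m : ℕ} {x : Fin d → ℝ}
    (h : P ∈ Q.descendants m) (hx : x ∈ P.toSet) : P = D.cell (Q.level - m) x := by
  rw [eq_cell_of_mem hx, (Cube.mem_descendants.1 h).1]

/-- The Lebesgue measure of the cubes of level `k`. -/
noncomputable def vol (k : ℤ) : ℝ≥0∞ := ENNReal.ofReal (D.unit * 2 ^ k) ^ d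

theorem toSet_eq_pi (Q : D.Cube) :
    Q.toSet = Set.univ.pi fun i => Set.Ico (Q.corner i) (Q.corner i + Q.side) := by
  ext x
  simp [Cube.toSet, box]

theorem measurableSet_toSet (Q : D.Cube) : MeasurableSet Q.toSet := by
  rw [toSet_eq_pi]
  exact MeasurableSet.univ_pi fun _ => measurableSet_Ico

theorem volume_toSet (Q : D.Cube) : volume Q.toSet = D.vol Q.level := by
  rw [toSet_eq_pi, Real.volume_pi_Ico]
  simp [vol, Cube.side]

@[simp] theorem volume_cell (k : ℤ) (x : Fin d → ℝ) :
    volume (D.cell k x).toSet = D.vol k := D.volume_toSet _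

theorem vol_ne_top (k : ℤ) : D.vol k ≠ ∞ := by simp [vol]

theorem vol_ne_zero (k : ℤ) : D.vol k ≠ 0 := by
  have : 0 < D.unit * 2 ^ k := mul_pos D.unit_pos (zpow_pos (by norm_num) _)
  simp only [vol, ne_eq]
  exact pow_ne_zero _ (by simpa using this)

theorem cube_vol (Q : D.Cube) : Q.vol = (D.vol Q.level).toReal := by
  rw [Cube.vol, measureReal_def, volume_toSet]

theorem vol_succ (k : ℤ) : D.vol (k + 1) = 2 ^ d * D.vol k := by
  have : D.unit * 2 ^ (k + 1) = 2 * (D.unit * 2 ^ k) := by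
    rw [zpow_add_one₀ (by norm_num)]; ring
  rw [vol, this, ENNReal.ofReal_mul (by norm_num), mul_pow, vol]
  simp

theorem countable_range_cell (k : ℤ) : (Set.range (D.cell k)).Countable := by
  apply Set.PairwiseDisjoint.countable_of_nonempty_interior (s := fun Q : D.Cube => Q.toSet)
  · rintro _ ⟨x, rfl⟩ _ ⟨y, rfl⟩ hxy
    refine Set.disjoint_left.2 fun z hz hz' => hxy ?_
    rw [← D.mem_cell_iff.1 hz, ← D.mem_cell_iff.1 hz']
  · rintro _ ⟨x, rfl⟩
    rw [toSet_eq_pi, interior_pi_set Set.finite_univ]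
    simp only [interior_Ico, Set.univ_pi_nonempty_iff, Set.nonempty_Ioo]
    intro i
    linarith [(D.cell k x).side_pos]

theorem measurableSet_cell_preimage (k : ℤ) (s : Set D.Cube) :
    MeasurableSet (D.cell k ⁻¹' s) := by
  have : D.cell k ⁻¹' s = ⋃ Q ∈ Set.range (D.cell k) ∩ s, Q.toSet := by
    ext x
    simp only [Set.mem_preimage, Set.mem_iUnion, Set.mem_inter_iff, Set.mem_range, exists_prop]
    constructor
    · exact fun h => ⟨_, ⟨⟨x, rfl⟩, h⟩, D.mem_cell k x⟩
    · rintro ⟨_, ⟨⟨y, rfl⟩, h⟩, hx⟩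
      rwa [D.mem_cell_iff.1 hx]
  rw [this]
  exact MeasurableSet.biUnion ((D.countable_range_cell k).mono Set.inter_subset_left)
    fun Q _ => D.measurableSet_toSet Q

/-- A function that is constant on the cubes of level `k` is measurable. -/
theorem measurable_of_const {β : Type*} [MeasurableSpace β] {g : (Fin d → ℝ) → β} (k : ℤ)
    (h : ∀ x y, D.cell k x = D.cell k y → g x = g y) : Measurable g := by
  intro t _
  have : g ⁻¹' t = D.cell k ⁻¹' (D.cell k '' (g ⁻¹' t)) := by
    refine Set.Subset.antisymm (Set.subset_preimage_image _ _) ?_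
    rintro x ⟨y, hy, e⟩
    rw [Set.mem_preimage, ← h y x e]
    exact hy
  rw [this]
  exact D.measurableSet_cell_preimage k _

/-- A function of two variables that is constant on products of cubes is measurable. -/
theorem measurable_of_const₂ {β : Type*} [MeasurableSpace β]
    {g : (Fin d → ℝ) → (Fin d → ℝ) → β} (k l : ℤ)
    (h₁ : ∀ x x' y, D.cell k x = D.cell k x' → g x y = g x' y)
    (h₂ : ∀ x y y', D.cell l y = D.cell l y' → g x y = g x y') :
    Measurable (Function.uncurry g) := by
  intro t _
  have : Function.uncurry g ⁻¹' t = ⋃ Q ∈ Set.range (D.cell l),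
      {x | ∃ y, D.cell l y = Q ∧ g x y ∈ t} ×ˢ (D.cell l ⁻¹' {Q}) := by
    ext ⟨x, y⟩
    simp only [Set.mem_preimage, Function.uncurry, Set.mem_iUnion, Set.mem_prod,
      Set.mem_ofPred_eq, Set.mem_singleton_iff, exists_prop]
    constructor
    · exact fun hg => ⟨_, ⟨y, rfl⟩, ⟨y, rfl, hg⟩, rfl⟩
    · rintro ⟨_, -, ⟨y', hy', hg⟩, rfl⟩
      rwa [← h₂ x y' y hy']
  rw [this]
  refine MeasurableSet.biUnion (D.countable_range_cell l) fun Q _ =>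
    MeasurableSet.prod ?_ (D.measurableSet_cell_preimage l _)
  refine measurableSet_setOfPred.2 (D.measurable_of_const k fun x x' e => ?_)
  simp only [h₁ x x' _ e]

/-- The average of `w` over the cube of level `k` that contains `x`. -/
noncomputable def avg (k : ℤ) (w : (Fin d → ℝ) → ℝ≥0∞) (x : Fin d → ℝ) : ℝ≥0∞ :=
  (D.vol k)⁻¹ * ∫⁻ z in (D.cell k x).toSet, w z

/-- The dyadic maximal function. -/
noncomputable def maximal (w : (Fin d → ℝ) → ℝ≥0∞) (x : Fin d → ℝ) : ℝ≥0∞ := ⨆ k, D.avg k w x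

theorem avg_congr {k l : ℤ} (h : l ≤ k) {w : (Fin d → ℝ) → ℝ≥0∞} {x y : Fin d → ℝ}
    (e : D.cell l x = D.cell l y) : D.avg k w x = D.avg k w y := by
  rw [avg, D.cell_eq_of_le h e, avg]

theorem measurable_avg (k : ℤ) (w : (Fin d → ℝ) → ℝ≥0∞) : Measurable (D.avg k w) :=
  D.measurable_of_const k fun _ _ e => D.avg_congr le_rfl e

theorem measurable_maximal (w : (Fin d → ℝ) → ℝ≥0∞) : Measurable (D.maximal w) :=
  Measurable.iSup fun k => D.measurable_avg k w

theorem avg_le_maximal (k : ℤ) (w : (Fin d → ℝ) → ℝ≥0∞) (x : Fin d → ℝ) :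
    D.avg k w x ≤ D.maximal w x := le_iSup (fun k => D.avg k w x) k

theorem avg_mono {k : ℤ} {w w' : (Fin d → ℝ) → ℝ≥0∞} {x : Fin d → ℝ}
    (h : ∀ z ∈ (D.cell k x).toSet, w z ≤ w' z) : D.avg k w x ≤ D.avg k w' x := by
  unfold avg
  gcongr 1
  exact setLIntegral_mono' (D.measurableSet_toSet _) h

theorem avg_le_avg_succ (k : ℤ) (w : (Fin d → ℝ) → ℝ≥0∞) (x : Fin d → ℝ) :
    D.avg k w x ≤ 2 ^ d * D.avg (k + 1) w x := by
  unfold avg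
  rw [vol_succ, ENNReal.mul_inv (by simp) (by simp), ← mul_assoc, ← mul_assoc,
    ENNReal.mul_inv_cancel (by simp) (by simp), one_mul]
  gcongr
  exact D.cell_subset (by omega) x

/-- The averaging operators are symmetric, and fix functions that are constant on cubes. -/
theorem lintegral_mul_avg (k : ℤ) {v w : (Fin d → ℝ) → ℝ≥0∞} (hw : Measurable w)
    (hv : ∀ x y, D.cell k x = D.cell k y → v x = v y) :
    ∫⁻ x, v x * D.avg k w x = ∫⁻ x, v x * w x := by
  classical
  have hvm : Measurable v := D.measurable_of_const k hv
  have hmem : MeasurableSet {p : (Fin d → ℝ) × (Fin d → ℝ) | D.cell k p.1 = D.cell k p.2} :=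
    measurableSet_setOfPred.2 (D.measurable_of_const₂ (g := fun x y => D.cell k x = D.cell k y) k k
      (fun x x' y e => by simp only [e]) (fun x y y' e => by simp only [e]))
  have hmeas : Measurable (Function.uncurry fun x z : Fin d → ℝ =>
      ({p : (Fin d → ℝ) × (Fin d → ℝ) | D.cell k p.1 = D.cell k p.2}.indicator
        (fun p => (D.vol k)⁻¹ * (v p.1 * w p.2)) (x, z))) := by
    refine Measurable.indicator ?_ hmem
    fun_prop
  have e1 : ∀ x, v x * D.avg k w x = ∫⁻ z,
      {p : (Fin d → ℝ) × (Fin d → ℝ) | D.cell k p.1 = D.cell k p.2}.indicator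
        (fun p => (D.vol k)⁻¹ * (v p.1 * w p.2)) (x, z) := by
    intro x
    rw [avg, mul_left_comm, ← lintegral_const_mul _ hw, ← lintegral_const_mul _ (by fun_prop),
      ← lintegral_indicator (D.measurableSet_toSet _)]
    refine lintegral_congr fun z => ?_
    simp only [Set.indicator_apply, Set.mem_ofPred_eq, mem_cell_iff, eq_comm]
  have e2 : ∀ z, v z * w z = ∫⁻ x,
      {p : (Fin d → ℝ) × (Fin d → ℝ) | D.cell k p.1 = D.cell k p.2}.indicator
        (fun p => (D.vol k)⁻¹ * (v p.1 * w p.2)) (x, z) := by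
    intro z
    have : ∀ x, {p : (Fin d → ℝ) × (Fin d → ℝ) | D.cell k p.1 = D.cell k p.2}.indicator
        (fun p => (D.vol k)⁻¹ * (v p.1 * w p.2)) (x, z) =
        (D.cell k z).toSet.indicator (fun _ => (D.vol k)⁻¹ * (v z * w z)) x := by
      intro x
      simp only [Set.indicator_apply, Set.mem_ofPred_eq, mem_cell_iff]
      split_ifs with h
      · rw [hv x z h]
      · rfl
    rw [lintegral_congr this, lintegral_indicator (D.measurableSet_toSet _), setLIntegral_const,
      volume_cell, mul_right_comm, ENNReal.inv_mul_cancel (D.vol_ne_zero k) (D.vol_ne_top k),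
      one_mul]
  rw [lintegral_congr e1, lintegral_congr e2]
  exact lintegral_lintegral_swap hmeas.aemeasurable

theorem lintegral_avg (k : ℤ) {w : (Fin d → ℝ) → ℝ≥0∞} (hw : Measurable w) :
    ∫⁻ x, D.avg k w x = ∫⁻ x, w x := by
  simpa using D.lintegral_mul_avg k (v := fun _ => 1) hw (by simp)

/-- The weak type `(1, 1)` inequality for the dyadic maximal function. -/
theorem mul_volume_maximal_le {w : (Fin d → ℝ) → ℝ≥0∞} (hw : Measurable w) (t : ℝ≥0∞) :
    t * volume {x | t < D.maximal w x} ≤ ∫⁻ x, w x := by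
  classical
  -- the levels at most `N`, with the stopping level `N - i`
  let A : ℕ → ℕ → Set (Fin d → ℝ) := fun N i =>
    {x | t < D.avg (N - i) w x ∧ ∀ j < i, D.avg (N - j) w x ≤ t}
  have hA : ∀ (N i : ℕ) x y, D.cell ((N : ℤ) - i) x = D.cell ((N : ℤ) - i) y →
      (x ∈ A N i ↔ y ∈ A N i) := by
    intro N i x y e
    simp only [A, Set.mem_ofPred_eq]
    rw [D.avg_congr le_rfl e]
    refine and_congr_right fun _ => forall₂_congr fun j hj => ?_
    rw [D.avg_congr (by omega) e]
  have hAm : ∀ N i, MeasurableSet (A N i) := fun N i =>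
    measurableSet_setOfPred.2 (D.measurable_of_const ((N : ℤ) - i) fun x y e => propext (hA N i x y e))
  have hdisj : ∀ N, Pairwise (Function.onFun Disjoint (A N)) := by
    intro N
    refine (symm_disjoint.comap _).pairwise_on (f := id) |>.2 ?_
    intro i j hij
    refine Set.disjoint_left.2 fun x hx hx' => ?_
    exact absurd (hx'.2 i hij) (not_le.2 hx.1)
  have hone : ∀ N i, t * volume (A N i) ≤ ∫⁻ x in A N i, w x := by
    intro N i
    have h1 : ∀ x y, D.cell ((N : ℤ) - i) x = D.cell ((N : ℤ) - i) y →
        (A N i).indicator (1 : (Fin d → ℝ) → ℝ≥0∞) x = (A N i).indicator 1 y := by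
      intro x y e
      simp only [Set.indicator_apply, hA N i x y e, Pi.one_apply]
    have h2 := D.lintegral_mul_avg _ hw h1
    calc t * volume (A N i) = ∫⁻ x, (A N i).indicator 1 x * t := by
          rw [lintegral_mul_const _ (measurable_one.indicator (hAm N i)),
            lintegral_indicator_one (hAm N i), mul_comm]
      _ ≤ ∫⁻ x, (A N i).indicator 1 x * D.avg (N - i) w x := by
          refine lintegral_mono fun x => ?_
          by_cases hx : x ∈ A N i
          · simpa [hx] using hx.1.le
          · simp [hx]
      _ = ∫⁻ x in A N i, w x := by
          rw [h2, ← lintegral_indicator (hAm N i)]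
          refine lintegral_congr fun x => ?_
          by_cases hx : x ∈ A N i <;> simp [hx]
  have hN : ∀ N, t * volume (⋃ i, A N i) ≤ ∫⁻ x, w x := by
    intro N
    rw [measure_iUnion (hdisj N) (hAm N), ← ENNReal.tsum_mul_left]
    refine (ENNReal.tsum_le_tsum (hone N)).trans ?_
    rw [← lintegral_iUnion (hAm N) (hdisj N)]
    exact setLIntegral_le_lintegral _ _
  have hU : ∀ N : ℕ, ⋃ i, A N i = {x | ∃ i : ℕ, t < D.avg (N - i) w x} := by
    classical
    intro N
    ext x
    simp only [A, Set.mem_iUnion, Set.mem_ofPred_eq]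
    refine ⟨fun ⟨i, hi, _⟩ => ⟨i, hi⟩, fun h => ⟨Nat.find h, Nat.find_spec h, fun j hj => ?_⟩⟩
    exact not_lt.1 (Nat.find_min h hj)
  have hmono : Monotone fun N => ⋃ i, A N i := by
    intro N N' h
    simp only [hU]
    rintro x ⟨i, hi⟩
    refine ⟨i + (N' - N), ?_⟩
    have : ((N' : ℤ) - ((i + (N' - N) : ℕ) : ℤ)) = N - i := by omega
    rwa [this]
  have hall : {x | t < D.maximal w x} = ⋃ N, ⋃ i, A N i := by
    ext x
    simp only [hU, maximal, lt_iSup_iff, Set.mem_ofPred_eq, Set.mem_iUnion]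
    constructor
    · rintro ⟨k, hk⟩
      refine ⟨k.toNat, (k.toNat - k).toNat, ?_⟩
      rwa [show ((k.toNat : ℤ) - ((k.toNat - k).toNat : ℤ)) = k by omega]
    · rintro ⟨N, i, h⟩
      exact ⟨_, h⟩
  rw [hall, hmono.measure_iUnion, ENNReal.mul_iSup]
  exact iSup_le hN

end DyadicGrid

theorem sq_setLIntegral_le {α : Type*} [MeasurableSpace α] {μ : Measure α} (s : Set α)
    {w : α → ℝ≥0∞} (hw : AEMeasurable w μ) :
    (∫⁻ x in s, w x ∂μ) ^ 2 ≤ μ s * ∫⁻ x in s, w x ^ 2 ∂μ := by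
  have h := ENNReal.lintegral_mul_le_Lp_mul_Lq (μ.restrict s) Real.HolderConjugate.two_two
    (f := 1) (g := w) aemeasurable_one hw.restrict
  simp only [one_mul, Pi.mul_apply, Pi.one_apply, lintegral_const,
    Measure.restrict_apply_univ, ENNReal.rpow_two, one_pow] at h
  calc (∫⁻ x in s, w x ∂μ) ^ 2 ≤ (μ s ^ (1 / 2 : ℝ) *
        (∫⁻ x in s, w x ^ 2 ∂μ) ^ (1 / 2 : ℝ)) ^ 2 := by gcongr
    _ = _ := by
      rw [mul_pow, ← ENNReal.rpow_natCast, ← ENNReal.rpow_mul, ← ENNReal.rpow_natCast,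
        ← ENNReal.rpow_mul]
      norm_num

theorem eLpNorm_two_sq {α E : Type*} [MeasurableSpace α] [NormedAddCommGroup E] {μ : Measure α}
    (f : α → E) : eLpNorm f 2 μ ^ 2 = ∫⁻ x, ‖f x‖ₑ ^ 2 ∂μ := by
  have := eLpNorm_nnreal_pow_eq_lintegral (f := f) (μ := μ) (p := 2) (by norm_num)
  simpa using this

theorem le_of_sq_le_sq {a b : ℝ≥0∞} (h : a ^ 2 ≤ b ^ 2) : a ≤ b :=
  (ENNReal.pow_right_strictMono (by norm_num)).le_iff_le.1 h

/-- If a bounded function is controlled in the weak sense on `L²`, it is controlled in `L²`. -/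
theorem eLpNorm_two_le_of_dual {X : Type*} [MeasurableSpace X] {μ : Measure X} [SigmaFinite μ]
    {G : X → ℂ} (hG : Measurable G) {M : ℝ} (hM : ∀ x, ‖G x‖ ≤ M) {c : ℝ≥0∞}
    (h : ∀ φ : X → ℂ, Measurable φ → MemLp φ 1 μ → MemLp φ 2 μ →
      ‖∫ x, G x * φ x ∂μ‖ₑ ≤ c * eLpNorm φ 2 μ) :
    eLpNorm G 2 μ ≤ c := by
  have key : ∀ n, eLpNorm ((spanningSets μ n).indicator G) 2 μ ≤ c := by
    intro n
    have hs := measurableSet_spanningSets μ n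
    have hfin := measure_spanningSets_lt_top μ n
    set φ : X → ℂ := (spanningSets μ n).indicator fun x => starRingEnd ℂ (G x) with hφ
    have hφm : Measurable φ := by
      refine Measurable.indicator ?_ hs
      exact Complex.continuous_conj.measurable.comp hG
    have hlp : ∀ p, MemLp φ p μ := by
      intro p
      rw [hφ, memLp_indicator_iff_restrict hs]
      have : IsFiniteMeasure (μ.restrict (spanningSets μ n)) :=
        ⟨by rwa [Measure.restrict_apply_univ]⟩
      refine MemLp.of_bound (C := M) ?_ ?_
      · exact (Complex.continuous_conj.measurable.comp hG).aestronglyMeasurable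
      · exact Eventually.of_forall fun x => by simpa using hM x
    have h1 := h φ hφm (hlp 1) (hlp 2)
    have e1 : eLpNorm φ 2 μ = eLpNorm ((spanningSets μ n).indicator G) 2 μ := by
      refine eLpNorm_congr_norm_ae (Eventually.of_forall fun x => ?_)
      by_cases hx : x ∈ spanningSets μ n <;> simp [φ, hx]
    have e2 : ∫ x, G x * φ x ∂μ =
        ((∫ x, ‖(spanningSets μ n).indicator G x‖ ^ 2 ∂μ : ℝ) : ℂ) := by
      rw [← integral_complex_ofReal]
      refine integral_congr_ae (Eventually.of_forall fun x => ?_)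
      by_cases hx : x ∈ spanningSets μ n <;> simp [φ, hx, Complex.mul_conj']
    have e3 : ‖∫ x, G x * φ x ∂μ‖ₑ = eLpNorm ((spanningSets μ n).indicator G) 2 μ ^ 2 := by
      have hi : Integrable (fun x => ‖(spanningSets μ n).indicator G x‖ ^ 2) μ := by
        have := (hlp 2).integrable_norm_pow (by norm_num)
        refine this.congr (Eventually.of_forall fun x => ?_)
        by_cases hx : x ∈ spanningSets μ n <;> simp [φ, hx]
      rw [e2, eLpNorm_two_sq, ← ofReal_norm, Complex.norm_real,
        Real.norm_of_nonneg (integral_nonneg fun _ => by positivity),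
        ofReal_integral_eq_lintegral_ofReal hi (Eventually.of_forall fun _ => by positivity)]
      refine lintegral_congr fun x => ?_
      rw [ENNReal.ofReal_pow (norm_nonneg _), ofReal_norm]
    rw [e3, e1] at h1
    have hf : eLpNorm ((spanningSets μ n).indicator G) 2 μ ≠ ∞ := e1 ▸ (hlp 2).2.ne
    rcases eq_or_ne (eLpNorm ((spanningSets μ n).indicator G) 2 μ) 0 with h0 | h0
    · simp [h0]
    · rw [sq] at h1
      exact (ENNReal.mul_le_mul_iff_left h0 hf).1 h1
  refine le_of_sq_le_sq ?_
  rw [eLpNorm_two_sq, ← setLIntegral_univ, ← iUnion_spanningSets μ,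
    setLIntegral_iUnion_of_directed _ (monotone_spanningSets μ).directed_le]
  refine iSup_le fun n => ?_
  have := pow_le_pow_left' (key n) 2
  rw [eLpNorm_two_sq, ← lintegral_indicator (measurableSet_spanningSets μ n)] at *
  refine le_trans (lintegral_mono fun x => ?_) this
  by_cases hx : x ∈ spanningSets μ n <;> simp [hx]

namespace DyadicGrid

variable {d : ℕ} (D : DyadicGrid d)

/-- The quadratic dyadic maximal function `(M |ψ|²)^{1/2}`. -/
noncomputable def maximalSq (ψ : (Fin d → ℝ) → ℂ) (x : Fin d → ℝ) : ℝ≥0∞ :=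
  D.maximal (fun z => ‖ψ z‖ₑ ^ 2) x ^ (1 / 2 : ℝ)

theorem maximalSq_sq (ψ : (Fin d → ℝ) → ℂ) (x : Fin d → ℝ) :
    D.maximalSq ψ x ^ 2 = D.maximal (fun z => ‖ψ z‖ₑ ^ 2) x := by
  rw [maximalSq, ← ENNReal.rpow_natCast, ← ENNReal.rpow_mul]
  norm_num

theorem measurable_maximalSq (ψ : (Fin d → ℝ) → ℂ) : Measurable (D.maximalSq ψ) :=
  (D.measurable_maximal _).pow_const _

theorem avg_sq_le (k : ℤ) {w : (Fin d → ℝ) → ℝ≥0∞} (hw : AEMeasurable w) (x : Fin d → ℝ) :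
    D.avg k w x ^ 2 ≤ D.avg k (fun z => w z ^ 2) x := by
  unfold avg
  calc ((D.vol k)⁻¹ * ∫⁻ z in (D.cell k x).toSet, w z) ^ 2
      ≤ (D.vol k)⁻¹ ^ 2 * (D.vol k * ∫⁻ z in (D.cell k x).toSet, w z ^ 2) := by
        rw [mul_pow]
        gcongr
        simpa using sq_setLIntegral_le (μ := volume) (D.cell k x).toSet hw
    _ = _ := by
        rw [sq, mul_assoc, ← mul_assoc _ (D.vol k),
          ENNReal.inv_mul_cancel (D.vol_ne_zero k) (D.vol_ne_top k), one_mul]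

theorem avg_le_maximalSq (k : ℤ) {ψ : (Fin d → ℝ) → ℂ} (hψ : AEStronglyMeasurable ψ)
    (x : Fin d → ℝ) : D.avg k (fun z => ‖ψ z‖ₑ) x ≤ D.maximalSq ψ x := by
  refine le_of_sq_le_sq ?_
  rw [maximalSq_sq]
  exact (D.avg_sq_le k hψ.enorm x).trans (D.avg_le_maximal k _ x)

theorem maximal_congr {w w' : (Fin d → ℝ) → ℝ≥0∞} (h : w =ᵐ[volume] w') :
    D.maximal w = D.maximal w' := by
  ext x
  simp only [maximal, avg]
  congr! 3 with k
  exact lintegral_congr_ae (ae_restrict_of_ae h)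

theorem sq_mul_volume_maximalSq_le {ψ : (Fin d → ℝ) → ℂ} (hψ : AEStronglyMeasurable ψ)
    (t : ℝ≥0∞) : t ^ 2 * volume {x | t < D.maximalSq ψ x} ≤ eLpNorm ψ 2 volume ^ 2 := by
  have e : {x | t < D.maximalSq ψ x} = {x | t ^ 2 < D.maximal (fun z => ‖hψ.mk ψ z‖ₑ ^ 2) x} := by
    ext x
    have : (fun z => ‖hψ.mk ψ z‖ₑ ^ 2) =ᵐ[volume] fun z => ‖ψ z‖ₑ ^ 2 := by
      filter_upwards [hψ.ae_eq_mk] with z hz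
      rw [hz]
    rw [Set.mem_ofPred_eq, Set.mem_ofPred_eq, D.maximal_congr this, ← maximalSq_sq]
    exact (ENNReal.pow_right_strictMono (by norm_num)).lt_iff_lt.symm
  rw [e, eLpNorm_congr_ae hψ.ae_eq_mk, eLpNorm_two_sq]
  exact D.mul_volume_maximal_le (hψ.stronglyMeasurable_mk.measurable.enorm.pow_const 2) _

theorem maximalSq_eq_zero {ψ : (Fin d → ℝ) → ℂ} (h : eLpNorm ψ 2 volume = 0) (x : Fin d → ℝ) :
    D.maximalSq ψ x = 0 := by
  have h' : ∫⁻ z, ‖ψ z‖ₑ ^ 2 = 0 := by rw [← eLpNorm_two_sq, h]; simp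
  have : D.maximal (fun z => ‖ψ z‖ₑ ^ 2) x = 0 := by
    simp only [maximal, ENNReal.iSup_eq_zero, avg]
    intro k
    rw [le_antisymm ((setLIntegral_le_lintegral _ _).trans h'.le) zero_le, mul_zero]
  simp [maximalSq, this]

theorem le_add_tsum (s : ℝ≥0∞) (hs : s ≠ 0) (a : ℝ≥0∞) :
    a ≤ s + ∑' i : ℕ, if 2 ^ i * s < a then 2 ^ (i + 1) * s else 0 := by
  classical
  by_cases h : ∃ i : ℕ, a ≤ 2 ^ i * s
  · have hs := Nat.find_spec h
    rcases hi : Nat.find h with _ | i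
    · rw [hi] at hs
      exact (by simpa using hs : a ≤ s).trans le_self_add
    · rw [hi] at hs
      have h2 := Nat.find_min h (m := i) (by omega)
      refine le_trans ?_ le_add_self
      refine le_trans ?_ (ENNReal.le_tsum i)
      rw [if_pos (not_le.1 h2)]
      exact hs
  · push Not at h
    have : (∑' i : ℕ, if 2 ^ i * s < a then 2 ^ (i + 1) * s else 0) = ∞ := by
      rw [eq_top_iff, ← ENNReal.tsum_const_eq_top_of_ne_zero (α := ℕ) hs]
      refine ENNReal.tsum_le_tsum fun i => ?_
      rw [if_pos (h i)]
      exact le_mul_of_one_le_left zero_le (one_le_pow₀ (by norm_num))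
    simp [this]

theorem lintegral_mul_maximalSq_le_add {F : (Fin d → ℝ) → ℝ≥0∞} (hF : Measurable F) {H : ℝ≥0∞}
    (hH : ∀ x, F x ≤ H) {ψ : (Fin d → ℝ) → ℂ} (hψ : AEStronglyMeasurable ψ)
    {s : ℝ≥0∞} (hs : s ≠ 0) (hs' : s ≠ ∞) :
    ∫⁻ x, F x * D.maximalSq ψ x ≤ s * (∫⁻ x, F x) + 4 * H * eLpNorm ψ 2 volume ^ 2 / s := by
  have hm : ∀ i : ℕ, MeasurableSet {x | 2 ^ i * s < D.maximalSq ψ x} := fun i =>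
    measurableSet_lt measurable_const (D.measurable_maximalSq ψ)
  have hterm : ∀ i : ℕ, 2 ^ (i + 1) * s * volume {x | 2 ^ i * s < D.maximalSq ψ x} ≤
      2 * eLpNorm ψ 2 volume ^ 2 / s * (2⁻¹) ^ i := by
    intro i
    have h := D.sq_mul_volume_maximalSq_le hψ (2 ^ i * s)
    calc 2 ^ (i + 1) * s * volume {x | 2 ^ i * s < D.maximalSq ψ x}
        = (2 * (2⁻¹) ^ i / s) * ((2 ^ i * s) ^ 2 *
            volume {x | 2 ^ i * s < D.maximalSq ψ x}) := by
          rw [← mul_assoc]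
          congr 1
          rw [ENNReal.div_eq_inv_mul, mul_pow, ← ENNReal.inv_pow]
          calc (2 : ℝ≥0∞) ^ (i + 1) * s = 2 * 2 ^ i * s * 1 * 1 := by ring
            _ = 2 * 2 ^ i * s * ((2 ^ i)⁻¹ * 2 ^ i) * (s⁻¹ * s) := by
              rw [ENNReal.inv_mul_cancel (by simp) (by simp), ENNReal.inv_mul_cancel hs hs']
            _ = _ := by ring
      _ ≤ (2 * (2⁻¹) ^ i / s) * eLpNorm ψ 2 volume ^ 2 := by gcongr
      _ = _ := by simp only [div_eq_mul_inv]; ring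
  calc ∫⁻ x, F x * D.maximalSq ψ x
      ≤ ∫⁻ x, (s * F x + H * ∑' i : ℕ, {x | 2 ^ i * s < D.maximalSq ψ x}.indicator
          (fun _ => 2 ^ (i + 1) * s) x) := by
        refine lintegral_mono fun x => ?_
        refine (mul_le_mul_right (le_add_tsum s hs (D.maximalSq ψ x)) (F x)).trans ?_
        rw [mul_add, mul_comm s]
        gcongr ?_ + ?_
        · exact le_rfl
        · refine mul_le_mul (hH x) (le_of_eq ?_) zero_le zero_le
          refine tsum_congr fun i => ?_
          simp [Set.indicator_apply]
    _ = s * (∫⁻ x, F x) + H * ∑' i : ℕ, 2 ^ (i + 1) * s *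
          volume {x | 2 ^ i * s < D.maximalSq ψ x} := by
        have : ∀ i : ℕ, Measurable fun x => {x | 2 ^ i * s < D.maximalSq ψ x}.indicator
          (fun _ => 2 ^ (i + 1) * s) x := fun i => measurable_const.indicator (hm i)
        rw [lintegral_add_left (by fun_prop), lintegral_const_mul _ hF,
          lintegral_const_mul _ (Measurable.tsum this),
          lintegral_tsum fun i => (this i).aemeasurable]
        simp_rw [lintegral_indicator_const (hm _)]
    _ ≤ s * (∫⁻ x, F x) + H * ∑' i : ℕ, 2 * eLpNorm ψ 2 volume ^ 2 / s * (2⁻¹) ^ i := by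
        exact add_le_add le_rfl (mul_le_mul_right (ENNReal.tsum_le_tsum hterm) H)
    _ = _ := by
        rw [ENNReal.tsum_mul_left, ENNReal.tsum_geometric, ENNReal.one_sub_inv_two, inv_inv]
        simp only [div_eq_mul_inv]
        ring

/-- `M₂` maps `L²` to weak `L²`, tested against functions that are bounded and integrable. -/
theorem lintegral_mul_maximalSq_le {F : (Fin d → ℝ) → ℝ≥0∞} (hF : Measurable F) {H : ℝ≥0∞}
    (hH : ∀ x, F x ≤ H) {ψ : (Fin d → ℝ) → ℂ} (hψ : AEStronglyMeasurable ψ) :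
    ∫⁻ x, F x * D.maximalSq ψ x ≤
      5 * (H * ∫⁻ x, F x) ^ (1 / 2 : ℝ) * eLpNorm ψ 2 volume := by
  set A := ∫⁻ x, F x with hA
  set N := eLpNorm ψ 2 volume with hN
  rcases eq_or_ne N 0 with h0 | h0
  · simp [D.maximalSq_eq_zero (hN ▸ h0)]
  rcases eq_or_ne A 0 with hA0 | hA0
  · have : F =ᵐ[volume] 0 := (lintegral_eq_zero_iff hF).1 hA0
    have : ∫⁻ x, F x * D.maximalSq ψ x = 0 := by
      rw [← lintegral_zero (μ := (volume : Measure (Fin d → ℝ)))]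
      refine lintegral_congr_ae ?_
      filter_upwards [this] with x hx
      simp [hx]
    simp [this]
  rcases eq_or_ne H 0 with hH0 | hH0
  · have : ∀ x, F x = 0 := fun x => le_antisymm ((hH x).trans hH0.le) zero_le
    simp [this]
  rcases eq_or_ne N ∞ with h1 | h1
  · simp [h1, hA0, hH0, ENNReal.mul_top]
  rcases eq_or_ne A ∞ with hA1 | hA1
  · simp [hA1, ENNReal.mul_top hH0, ENNReal.top_mul h0]
  rcases eq_or_ne H ∞ with hH1 | hH1
  · simp [hH1, ENNReal.top_mul hA0, ENNReal.top_mul h0]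
  set R := (H * A) ^ (1 / 2 : ℝ) with hR
  have hRR : R * R = H * A := by
    rw [hR, ← ENNReal.rpow_add_of_nonneg _ _ (by norm_num) (by norm_num)]
    norm_num
  have hR0 : R ≠ 0 := by
    rintro h; rw [h] at hRR; simp [hA0, hH0] at hRR
  have hR1 : R ≠ ∞ := by
    rintro h; rw [h] at hRR; exact ENNReal.mul_ne_top hH1 hA1 (by simpa using hRR.symm)
  have hs : R * N / A ≠ 0 := by simp [hR0, h0, hA1]
  have hs' : R * N / A ≠ ∞ := ENNReal.div_ne_top (ENNReal.mul_ne_top hR1 h1) hA0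
  refine (D.lintegral_mul_maximalSq_le_add hF hH hψ hs hs').trans (le_of_eq ?_)
  have e1 : R * N / A * A = R * N := ENNReal.div_mul_cancel hA0 hA1
  have e2 : 4 * H * N ^ 2 / (R * N / A) = 4 * R * N := by
    refine ((ENNReal.eq_div_iff hs hs').2 (Eq.symm ?_)).symm
    calc 4 * H * N ^ 2 = 4 * H * (A * A⁻¹) * N ^ 2 := by
          rw [ENNReal.mul_inv_cancel hA0 hA1, mul_one]
      _ = 4 * (H * A) * A⁻¹ * N ^ 2 := by ring
      _ = R * N / A * (4 * R * N) := by rw [← hRR, div_eq_mul_inv]; ring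
  rw [e1, e2]
  ring

end DyadicGrid

theorem sum_Icc_add_sum_Icc {M : Type*} [AddCommMonoid M] (F : ℤ → M) {a b c : ℤ}
    (h₁ : a ≤ b + 1) (h₂ : b ≤ c) :
    ∑ k ∈ Finset.Icc a b, F k + ∑ k ∈ Finset.Icc (b + 1) c, F k = ∑ k ∈ Finset.Icc a c, F k := by
  rw [← Finset.sum_union]
  · congr 1
    ext k
    simp only [Finset.mem_union, Finset.mem_Icc]
    omega
  · refine Finset.disjoint_left.2 fun k hk hk' => ?_
    simp only [Finset.mem_Icc] at hk hk'
    omega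

/-- A family of kernels adapted to a dyadic grid: the `k`-th kernel is supported on the products
`Q × Q` of cubes of level `k`, is bounded by `1 / |Q|`, and is constant on products of descendants
of `Q`. -/
structure DyadicKernel {d : ℕ} (D : DyadicGrid d) (m n : ℕ) where
  K : ℤ → (Fin d → ℝ) → (Fin d → ℝ) → ℂ
  supp : ∀ k x y, D.cell k x ≠ D.cell k y → K k x y = 0
  bound : ∀ k x y, ‖K k x y‖ₑ ≤ (D.vol k)⁻¹
  left : ∀ k x x' y, D.cell (k - m - 1) x = D.cell (k - m - 1) x' → K k x y = K k x' y
  right : ∀ k x y y', D.cell (k - n - 1) y = D.cell (k - n - 1) y' → K k x y = K k x y'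

namespace DyadicKernel

variable {d : ℕ} {D : DyadicGrid d} {m n : ℕ} (𝒦 : DyadicKernel D m n)

/-- The kernels of the transposed operators. -/
def transpose : DyadicKernel D n m where
  K k x y := 𝒦.K k y x
  supp k x y h := 𝒦.supp k y x (Ne.symm h)
  bound k x y := 𝒦.bound k y x
  left k x x' y := 𝒦.right k y x x'
  right k x y y' := 𝒦.left k y y' x

/-- The integral operator with kernel `K k`. -/
noncomputable def op (k : ℤ) (f : (Fin d → ℝ) → ℂ) (x : Fin d → ℝ) : ℂ := ∫ y, 𝒦.K k x y * f y

theorem measurable_K (k : ℤ) : Measurable (Function.uncurry (𝒦.K k)) :=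
  D.measurable_of_const₂ (k - m - 1) (k - n - 1) (𝒦.left k) (𝒦.right k)

theorem op_congr {k l : ℤ} (h : l ≤ k - m - 1) {x x' : Fin d → ℝ} (e : D.cell l x = D.cell l x')
    (f : (Fin d → ℝ) → ℂ) : 𝒦.op k f x = 𝒦.op k f x' := by
  simp only [op, 𝒦.left k x x' _ (D.cell_eq_of_le h e)]

theorem op_congr_right {k : ℤ} {x : Fin d → ℝ} {f g : (Fin d → ℝ) → ℂ}
    (h : ∀ y, D.cell k y = D.cell k x → f y = g y) : 𝒦.op k f x = 𝒦.op k g x := by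
  unfold op
  congr 1
  ext y
  by_cases e : D.cell k y = D.cell k x
  · rw [h y e]
  · rw [𝒦.supp k x y (Ne.symm e), zero_mul, zero_mul]

theorem measurable_op (k : ℤ) (f : (Fin d → ℝ) → ℂ) : Measurable (𝒦.op k f) :=
  D.measurable_of_const (k - m - 1) fun _ _ e => 𝒦.op_congr le_rfl e f

theorem enorm_op_le (k : ℤ) (f : (Fin d → ℝ) → ℂ) (x : Fin d → ℝ) :
    ‖𝒦.op k f x‖ₑ ≤ D.avg k (fun y => ‖f y‖ₑ) x := by
  refine (enorm_integral_le_lintegral_enorm _).trans ?_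
  rw [DyadicGrid.avg, ← lintegral_const_mul' _ _ (ENNReal.inv_ne_top.2 (D.vol_ne_zero k)),
    ← lintegral_indicator (D.measurableSet_toSet _)]
  refine lintegral_mono fun y => ?_
  by_cases h : y ∈ (D.cell k x).toSet
  · rw [Set.indicator_of_mem h, enorm_mul]
    gcongr
    exact 𝒦.bound k x y
  · rw [𝒦.supp k x y (fun e => h (D.mem_cell_iff.2 e.symm))]
    simp

theorem integrable_op (k : ℤ) {f : (Fin d → ℝ) → ℂ} (hf : Integrable f) :
    Integrable (𝒦.op k f) := by
  refine ⟨(𝒦.measurable_op k f).aestronglyMeasurable, ?_⟩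
  refine lt_of_le_of_lt (lintegral_mono (𝒦.enorm_op_le k f)) ?_
  have h := hf.1
  have e : D.avg k (fun y => ‖f y‖ₑ) = D.avg k (fun y => ‖h.mk f y‖ₑ) := by
    ext x
    unfold DyadicGrid.avg
    congr 1
    refine lintegral_congr_ae (ae_restrict_of_ae ?_)
    filter_upwards [h.ae_eq_mk] with y hy
    rw [hy]
  rw [e, D.lintegral_avg k h.stronglyMeasurable_mk.measurable.enorm]
  have h2 : ∫⁻ x, ‖h.mk f x‖ₑ = ∫⁻ x, ‖f x‖ₑ := by
    refine lintegral_congr_ae ?_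
    filter_upwards [h.ae_eq_mk] with y hy
    rw [hy]
  rw [h2]
  exact hf.2

theorem integrable_mul_op {k : ℤ} {f g : (Fin d → ℝ) → ℂ} (hf : Integrable f)
    (hg : Integrable g) :
    Integrable (fun p : (Fin d → ℝ) × (Fin d → ℝ) => 𝒦.K k p.1 p.2 * (g p.1 * f p.2))
      (volume.prod volume) := by
  refine Integrable.bdd_mul (c := (D.vol k)⁻¹.toReal) (hg.mul_prod hf)
    (𝒦.measurable_K k).aestronglyMeasurable (Eventually.of_forall fun p => ?_)
  have := ENNReal.toReal_mono (ENNReal.inv_ne_top.2 (D.vol_ne_zero k)) (𝒦.bound k p.1 p.2)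
  simpa using this

/-- The transposed kernel defines the transposed operator. -/
theorem integral_mul_op (k : ℤ) {f g : (Fin d → ℝ) → ℂ} (hf : Integrable f)
    (hg : Integrable g) :
    ∫ x, g x * 𝒦.op k f x = ∫ y, 𝒦.transpose.op k g y * f y := by
  have h := integral_integral_swap (f := fun x y => 𝒦.K k x y * (g x * f y))
    (𝒦.integrable_mul_op hf hg)
  calc ∫ x, g x * 𝒦.op k f x = ∫ x, ∫ y, 𝒦.K k x y * (g x * f y) := by
        refine integral_congr_ae (Eventually.of_forall fun x => ?_)
        simp only [op]
        rw [← integral_const_mul]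
        congr 1; ext y; ring
    _ = _ := by
        rw [h]
        refine integral_congr_ae (Eventually.of_forall fun y => ?_)
        simp only [op, transpose]
        rw [← integral_mul_const]
        congr 1; ext x; ring

theorem enorm_sum_op_le (s : Finset ℤ) (f : (Fin d → ℝ) → ℂ) (x : Fin d → ℝ) :
    ‖∑ k ∈ s, 𝒦.op k f x‖ₑ ≤ ∑ k ∈ s, D.avg k (fun y => ‖f y‖ₑ) x :=
  (enorm_sum_le _ _).trans (Finset.sum_le_sum fun k _ => 𝒦.enorm_op_le k f x)

/-- The levels `k` for which the kernel does not vanish. -/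
def active : Set ℤ := {k | ∃ x y, 𝒦.K k x y ≠ 0}

theorem op_eq_zero {k : ℤ} (h : k ∉ 𝒦.active) (f : (Fin d → ℝ) → ℂ) (x : Fin d → ℝ) :
    𝒦.op k f x = 0 := by
  have : ∀ y, 𝒦.K k x y = 0 := fun y => by
    by_contra h'
    exact h ⟨x, y, h'⟩
  simp [op, this]

theorem active_transpose : 𝒦.transpose.active = 𝒦.active := by
  ext k
  exact exists_comm

open Classical in
/-- Among any `m` consecutive levels, at most `ν` are active. -/
def Sparse (ν : ℕ) : Prop :=
  ∀ j : ℤ, ((Finset.Icc (j + 1) (j + m)).filter (· ∈ 𝒦.active)).card ≤ ν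

open Classical in
theorem sum_op_eq_filter (s : Finset ℤ) (f : (Fin d → ℝ) → ℂ) (x : Fin d → ℝ) :
    ∑ k ∈ s, 𝒦.op k f x = ∑ k ∈ s.filter (· ∈ 𝒦.active), 𝒦.op k f x := by
  refine (Finset.sum_filter_of_ne fun k _ hk => ?_).symm
  by_contra h
  exact hk (𝒦.op_eq_zero h f x)

/-- The operator `∑ k, op k`, summed over growing intervals of levels, is bounded on `L²`. -/
def IsL2Bounded (B : ℝ≥0∞) (lo hi : ℕ → ℤ) : Prop :=
  ∀ φ : (Fin d → ℝ) → ℂ, Measurable φ → MemLp φ 1 → MemLp φ 2 →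
    ∃ ψ : (Fin d → ℝ) → ℂ, MemLp ψ 2 ∧ eLpNorm ψ 2 volume ≤ B * eLpNorm φ 2 volume ∧
      ∀ k z, Tendsto (fun N => ∫ x in (D.cell k z).toSet,
        ∑ i ∈ Finset.Icc (lo N) (hi N), 𝒦.op i φ x) atTop (𝓝 (∫ x in (D.cell k z).toSet, ψ x))

end DyadicKernel

theorem DyadicGrid.sum_inv_vol_add_le {d : ℕ} (D : DyadicGrid d) (hd : 1 ≤ d) (p : ℤ) (j : ℕ) :
    ∑ k ∈ Finset.Icc (p + 1) (p + j), (D.vol k)⁻¹ + (D.vol (p + j))⁻¹ ≤ (D.vol p)⁻¹ := by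
  induction j with
  | zero => simp
  | succ j ih =>
    have h := sum_Icc_add_sum_Icc (fun k => (D.vol k)⁻¹) (a := p + 1) (b := p + j)
      (c := p + (j + 1 : ℕ)) (by omega) (by omega)
    have e : p + ((j + 1 : ℕ) : ℤ) = p + j + 1 := by push_cast; ring
    rw [← h, e, Finset.Icc_self, Finset.sum_singleton, add_assoc]
    refine le_trans (add_le_add le_rfl ?_) ih
    rw [vol_succ, ENNReal.mul_inv (by simp) (by simp), ← two_mul, ← mul_assoc]
    refine mul_le_of_le_one_left zero_le ?_
    rw [← div_eq_mul_inv]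
    refine ENNReal.div_le_of_le_mul ?_
    rw [one_mul]
    exact le_self_pow₀ (by norm_num) (by omega)

theorem DyadicGrid.sum_inv_vol_le {d : ℕ} (D : DyadicGrid d) (hd : 1 ≤ d) (p q : ℤ) :
    ∑ k ∈ Finset.Icc (p + 1) q, (D.vol k)⁻¹ ≤ (D.vol p)⁻¹ := by
  rcases le_total p q with h | h
  · obtain ⟨j, rfl⟩ := Int.le.dest h
    exact le_self_add.trans (D.sum_inv_vol_add_le hd p j)
  · rw [Finset.Icc_eq_empty (by omega)]
    simp

namespace DyadicKernel

variable {d : ℕ} {D : DyadicGrid d} {m n : ℕ} (𝒦 : DyadicKernel D m n)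

theorem op_indicator {k l : ℤ} (h : k ≤ l) {x z : Fin d → ℝ} (hz : z ∈ (D.cell l x).toSet)
    (f : (Fin d → ℝ) → ℂ) : 𝒦.op k ((D.cell l x).toSet.indicator f) z = 𝒦.op k f z := by
  refine 𝒦.op_congr_right fun y hy => Set.indicator_of_mem ?_ _
  rw [D.mem_cell_iff] at hz ⊢
  rw [← hz]
  exact D.cell_eq_of_le h hy

theorem sum_avg_indicator_le (hd : 1 ≤ d) (p q : ℤ) (w : (Fin d → ℝ) → ℝ≥0∞)
    (x z : Fin d → ℝ) :
    ∑ k ∈ Finset.Icc (p + 1) q, D.avg k ((D.cell p x).toSet.indicator w) z ≤ D.avg p w x := by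
  calc ∑ k ∈ Finset.Icc (p + 1) q, D.avg k ((D.cell p x).toSet.indicator w) z
      ≤ ∑ k ∈ Finset.Icc (p + 1) q, (D.vol k)⁻¹ * ∫⁻ y in (D.cell p x).toSet, w y := by
        refine Finset.sum_le_sum fun k _ => ?_
        unfold DyadicGrid.avg
        refine mul_le_mul_right ?_ _
        rw [← lintegral_indicator (D.measurableSet_toSet (D.cell p x))]
        exact setLIntegral_le_lintegral _ _
    _ ≤ _ := by
        rw [← Finset.sum_mul]
        exact mul_le_mul_left (D.sum_inv_vol_le hd p q) _

/-- The averaging argument behind Cotlar's inequality. -/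
theorem enorm_sum_op_le_average (hd : 1 ≤ d) {ν : ℕ} (hν : 𝒦.Sparse ν) {φ : (Fin d → ℝ) → ℂ}
    (hφ : Integrable φ) {lo hi p : ℤ} (h₁ : lo ≤ p + 1) (h₂ : p + m ≤ hi) (x : Fin d → ℝ) :
    ‖∑ k ∈ Finset.Icc (p + m + 1) hi, 𝒦.op k φ x‖ₑ ≤
      (D.vol p)⁻¹ * ‖(∫ z in (D.cell p x).toSet, ∑ k ∈ Finset.Icc lo hi, 𝒦.op k φ z) -
        ∫ z in (D.cell p x).toSet, ∑ k ∈ Finset.Icc lo hi,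
          𝒦.op k ((D.cell p x).toSet.indicator φ) z‖ₑ + (ν + 1) * D.maximalSq φ x := by
  set P := (D.cell p x).toSet with hP
  have hPm : MeasurableSet P := D.measurableSet_toSet _
  have hφP : Integrable (P.indicator φ) := hφ.indicator hPm
  set A := ∑ k ∈ Finset.Icc (p + m + 1) hi, 𝒦.op k φ x
  set R : (Fin d → ℝ) → ℂ := fun z => ∑ k ∈ Finset.Icc (p + 1) (p + m), 𝒦.op k φ z -
    ∑ k ∈ Finset.Icc (p + 1) hi, 𝒦.op k (P.indicator φ) z with hR
  have hint : ∀ (s : Finset ℤ) {f : (Fin d → ℝ) → ℂ}, Integrable f →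
      Integrable (fun z => ∑ k ∈ s, 𝒦.op k f z) (volume.restrict P) := fun s f hf =>
    (integrable_finsetSum s fun k _ => 𝒦.integrable_op k hf).restrict
  have hpt : ∀ z ∈ P, ∑ k ∈ Finset.Icc lo hi, 𝒦.op k φ z -
      ∑ k ∈ Finset.Icc lo hi, 𝒦.op k (P.indicator φ) z = A + R z := by
    intro z hz
    rw [← sum_Icc_add_sum_Icc _ h₁ (by omega : p ≤ hi),
      ← sum_Icc_add_sum_Icc (fun k => 𝒦.op k (P.indicator φ) z) h₁ (by omega : p ≤ hi),
      ← sum_Icc_add_sum_Icc (fun k => 𝒦.op k φ z) (by omega : p + 1 ≤ p + m + 1) h₂]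
    have e1 : ∑ k ∈ Finset.Icc lo p, 𝒦.op k (P.indicator φ) z =
        ∑ k ∈ Finset.Icc lo p, 𝒦.op k φ z :=
      Finset.sum_congr rfl fun k hk => 𝒦.op_indicator (Finset.mem_Icc.1 hk).2 hz φ
    have e2 : ∑ k ∈ Finset.Icc (p + m + 1) hi, 𝒦.op k φ z = A :=
      Finset.sum_congr rfl fun k hk =>
        𝒦.op_congr (by have := (Finset.mem_Icc.1 hk).1; omega) (D.mem_cell_iff.1 hz) φ
    rw [e1, e2, hR]
    ring
  have hRle : ∀ z ∈ P, ‖R z‖ₑ ≤ (ν + 1) * D.maximalSq φ x := by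
    intro z hz
    refine enorm_sub_le.trans ?_
    rw [add_mul, one_mul]
    refine add_le_add ?_ ?_
    · classical
      rw [sum_op_eq_filter]
      refine (𝒦.enorm_sum_op_le _ _ _).trans ?_
      refine (Finset.sum_le_card_nsmul _ _ (D.maximalSq φ x) fun k hk => ?_).trans ?_
      · rw [D.avg_congr (l := p) (by
          have := (Finset.mem_Icc.1 (Finset.mem_filter.1 hk).1).1; omega) (D.mem_cell_iff.1 hz)]
        exact D.avg_le_maximalSq k hφ.1 x
      · rw [nsmul_eq_mul]
        gcongr
        exact hν p
    · refine (𝒦.enorm_sum_op_le _ _ _).trans ?_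
      refine le_trans (le_of_eq ?_) ((sum_avg_indicator_le hd p hi (fun y => ‖φ y‖ₑ) x z).trans
        (D.avg_le_maximalSq p hφ.1 x))
      refine Finset.sum_congr rfl fun k _ => ?_
      congr 1
      ext y
      exact enorm_indicator_eq_indicator_enorm _ _
  have hRi : Integrable R (volume.restrict P) := (hint _ hφ).sub (hint _ hφP)
  have hreal : volume.real P = (D.vol p).toReal := by
    rw [measureReal_def, hP, D.volume_cell]
  have hmain : ((D.vol p).toReal : ℂ) * A = ((∫ z in P, ∑ k ∈ Finset.Icc lo hi, 𝒦.op k φ z) -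
      ∫ z in P, ∑ k ∈ Finset.Icc lo hi, 𝒦.op k (P.indicator φ) z) - ∫ z in P, R z := by
    have hconst : Integrable (fun _ : Fin d → ℝ => A) (volume.restrict P) :=
      integrableOn_const (by rw [hP, D.volume_cell]; exact D.vol_ne_top p)
    rw [← integral_sub (hint _ hφ) (hint _ hφP), setIntegral_congr_fun hPm hpt,
      integral_add hconst hRi, setIntegral_const, hreal, Complex.real_smul, add_sub_cancel_right]
  have hRint : ‖∫ z in P, R z‖ₑ ≤ D.vol p * ((ν + 1) * D.maximalSq φ x) := by
    refine (enorm_integral_le_lintegral_enorm _).trans ?_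
    refine (setLIntegral_mono' hPm hRle).trans ?_
    rw [setLIntegral_const, hP, D.volume_cell, mul_comm]
  have hnorm : ‖((D.vol p).toReal : ℂ)‖ₑ = D.vol p := by
    rw [← ofReal_norm, Complex.norm_real, Real.norm_of_nonneg ENNReal.toReal_nonneg,
      ENNReal.ofReal_toReal (D.vol_ne_top p)]
  have h0 := D.vol_ne_zero p
  have h1 := D.vol_ne_top p
  calc ‖A‖ₑ = (D.vol p)⁻¹ * ‖((D.vol p).toReal : ℂ) * A‖ₑ := by
        rw [enorm_mul, hnorm, ← mul_assoc, ENNReal.inv_mul_cancel h0 h1, one_mul]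
    _ ≤ (D.vol p)⁻¹ * (‖(∫ z in P, ∑ k ∈ Finset.Icc lo hi, 𝒦.op k φ z) -
      ∫ z in P, ∑ k ∈ Finset.Icc lo hi, 𝒦.op k (P.indicator φ) z‖ₑ +
        D.vol p * ((ν + 1) * D.maximalSq φ x)) := by
        rw [hmain]
        gcongr
        exact enorm_sub_le.trans (add_le_add le_rfl hRint)
    _ = _ := by
        rw [mul_add, ← mul_assoc _ (D.vol p), ENNReal.inv_mul_cancel h0 h1, one_mul]

theorem inv_vol_mul_enorm_integral_le (p : ℤ) (x : Fin d → ℝ) {ψ : (Fin d → ℝ) → ℂ} :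
    (D.vol p)⁻¹ * ‖∫ z in (D.cell p x).toSet, ψ z‖ₑ ≤ D.avg p (fun z => ‖ψ z‖ₑ) x := by
  unfold DyadicGrid.avg
  gcongr
  exact enorm_integral_le_lintegral_enorm _

theorem avg_le_of_eLpNorm_le (p : ℤ) (x : Fin d → ℝ) {φ ψ : (Fin d → ℝ) → ℂ}
    (hψ : AEStronglyMeasurable ψ) {B : ℝ≥0∞}
    (h : eLpNorm ψ 2 volume ≤ B * eLpNorm ((D.cell p x).toSet.indicator φ) 2 volume) :
    D.avg p (fun z => ‖ψ z‖ₑ) x ≤ B * D.maximalSq φ x := by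
  refine le_of_sq_le_sq ?_
  rw [mul_pow, D.maximalSq_sq]
  have h2 := pow_le_pow_left' h 2
  rw [mul_pow, eLpNorm_two_sq, eLpNorm_two_sq] at h2
  calc D.avg p (fun z => ‖ψ z‖ₑ) x ^ 2 ≤ D.avg p (fun z => ‖ψ z‖ₑ ^ 2) x :=
        D.avg_sq_le p hψ.enorm x
    _ ≤ (D.vol p)⁻¹ * ∫⁻ z, ‖ψ z‖ₑ ^ 2 := by
        unfold DyadicGrid.avg
        gcongr
        exact Measure.restrict_le_self
    _ ≤ (D.vol p)⁻¹ * (B ^ 2 * ∫⁻ z, ‖(D.cell p x).toSet.indicator φ z‖ₑ ^ 2) := by gcongr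
    _ = B ^ 2 * D.avg p (fun z => ‖φ z‖ₑ ^ 2) x := by
        unfold DyadicGrid.avg
        rw [mul_left_comm, ← lintegral_indicator (D.measurableSet_toSet _)]
        congr 3
        ext z
        by_cases hz : z ∈ (D.cell p x).toSet <;> simp [hz]
    _ ≤ _ := by
        gcongr
        exact D.avg_le_maximal p _ x

/-- Cotlar's inequality: the truncated sums are controlled pointwise by quadratic maximal
functions. -/
theorem exists_enorm_sum_op_le (hd : 1 ≤ d) {ν : ℕ} (hν : 𝒦.Sparse ν) {B : ℝ≥0∞}
    {lo hi : ℕ → ℤ} (hlo : Tendsto lo atTop atBot) (hhi : Tendsto hi atTop atTop)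
    (hB : 𝒦.IsL2Bounded B lo hi) {φ : (Fin d → ℝ) → ℂ} (hφm : Measurable φ)
    (hφ₁ : MemLp φ 1) (hφ₂ : MemLp φ 2) :
    ∃ ψ : (Fin d → ℝ) → ℂ, MemLp ψ 2 ∧ eLpNorm ψ 2 volume ≤ B * eLpNorm φ 2 volume ∧
      ∀ a b x, ‖∑ k ∈ Finset.Icc a b, 𝒦.op k φ x‖ₑ ≤
        2 * (D.maximalSq ψ x + (B + ν + 1) * D.maximalSq φ x) := by
  obtain ⟨ψ, hψ, hψB, hlim⟩ := hB φ hφm hφ₁ hφ₂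
  have hφi : Integrable φ := memLp_one_iff_integrable.1 hφ₁
  refine ⟨ψ, hψ, hψB, fun a b x => ?_⟩
  -- sums without an upper truncation
  have hone : ∀ p : ℤ, ∃ E : ℕ → ℝ≥0∞, ∃ e : ℝ≥0∞, Tendsto E atTop (𝓝 e) ∧
      e ≤ D.maximalSq ψ x + B * D.maximalSq φ x ∧
      ∀ᶠ N in atTop, ‖∑ k ∈ Finset.Icc (p + m + 1) (hi N), 𝒦.op k φ x‖ₑ ≤
        E N + (ν + 1) * D.maximalSq φ x := by
    intro p
    have hPm : MeasurableSet (D.cell p x).toSet := D.measurableSet_toSet _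
    obtain ⟨ψ', hψ', hψB', hlim'⟩ := hB ((D.cell p x).toSet.indicator φ) (hφm.indicator hPm)
      (hφ₁.indicator hPm) (hφ₂.indicator hPm)
    refine ⟨_, _, ENNReal.Tendsto.const_mul (((hlim p x).sub (hlim' p x)).enorm)
      (Or.inr (ENNReal.inv_ne_top.2 (D.vol_ne_zero p))), ?_, ?_⟩
    · refine (mul_le_mul_right enorm_sub_le _).trans ?_
      rw [mul_add]
      refine add_le_add ?_ ?_
      · exact (inv_vol_mul_enorm_integral_le p x).trans (D.avg_le_maximalSq p hψ.1 x)
      · exact (inv_vol_mul_enorm_integral_le p x).trans (avg_le_of_eLpNorm_le p x hψ'.1 hψB')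
    · filter_upwards [hlo.eventually_le_atBot (p + 1), hhi.eventually_ge_atTop (p + m)]
        with N h1 h2
      exact 𝒦.enorm_sum_op_le_average hd hν hφi h1 h2 x
  by_cases hab : a ≤ b + 1
  swap
  · rw [Finset.Icc_eq_empty (by omega)]
    simp
  obtain ⟨E, e, hE, he, hEN⟩ := hone (a - m - 1)
  obtain ⟨E', e', hE', he', hEN'⟩ := hone (b - m)
  have hlim2 : Tendsto (fun N => (E N + (ν + 1) * D.maximalSq φ x) +
      (E' N + (ν + 1) * D.maximalSq φ x)) atTop
      (𝓝 ((e + (ν + 1) * D.maximalSq φ x) + (e' + (ν + 1) * D.maximalSq φ x))) :=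
    (hE.add tendsto_const_nhds).add (hE'.add tendsto_const_nhds)
  have hle : ‖∑ k ∈ Finset.Icc a b, 𝒦.op k φ x‖ₑ ≤
      (e + (ν + 1) * D.maximalSq φ x) + (e' + (ν + 1) * D.maximalSq φ x) := by
    refine ge_of_tendsto hlim2 ?_
    filter_upwards [hEN, hEN', hhi.eventually_ge_atTop b] with N h1 h2 h3
    rw [show a - m - 1 + (m : ℤ) + 1 = a by ring] at h1
    rw [show b - m + (m : ℤ) + 1 = b + 1 by ring] at h2
    have : ∑ k ∈ Finset.Icc a b, 𝒦.op k φ x = ∑ k ∈ Finset.Icc a (hi N), 𝒦.op k φ x -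
        ∑ k ∈ Finset.Icc (b + 1) (hi N), 𝒦.op k φ x := by
      rw [← sum_Icc_add_sum_Icc _ hab h3, add_sub_cancel_right]
    rw [this]
    exact enorm_sub_le.trans (add_le_add h1 h2)
  refine hle.trans ?_
  calc (e + (ν + 1) * D.maximalSq φ x) + (e' + (ν + 1) * D.maximalSq φ x)
      ≤ ((D.maximalSq ψ x + B * D.maximalSq φ x) + (ν + 1) * D.maximalSq φ x) +
        ((D.maximalSq ψ x + B * D.maximalSq φ x) + (ν + 1) * D.maximalSq φ x) := by gcongr
    _ = _ := by ring

/-- The maximal truncations. -/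
noncomputable def maxTrunc (φ : (Fin d → ℝ) → ℂ) (x : Fin d → ℝ) : ℝ≥0∞ :=
  ⨆ a, ⨆ b, ‖∑ k ∈ Finset.Icc a b, 𝒦.op k φ x‖ₑ

theorem enorm_sum_le_maxTrunc (a b : ℤ) (φ : (Fin d → ℝ) → ℂ) (x : Fin d → ℝ) :
    ‖∑ k ∈ Finset.Icc a b, 𝒦.op k φ x‖ₑ ≤ 𝒦.maxTrunc φ x :=
  le_iSup₂ (f := fun a b => ‖∑ k ∈ Finset.Icc a b, 𝒦.op k φ x‖ₑ) a b

/-- The maximal truncations map `L²` to weak `L²`, tested against functions that are bounded and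
integrable. -/
theorem lintegral_mul_maxTrunc_le (hd : 1 ≤ d) {ν : ℕ} (hν : 𝒦.Sparse ν) {B : ℝ≥0∞}
    {lo hi : ℕ → ℤ} (hlo : Tendsto lo atTop atBot) (hhi : Tendsto hi atTop atTop)
    (hB : 𝒦.IsL2Bounded B lo hi) {φ : (Fin d → ℝ) → ℂ} (hφm : Measurable φ)
    (hφ₁ : MemLp φ 1) (hφ₂ : MemLp φ 2) {F : (Fin d → ℝ) → ℝ≥0∞} (hF : Measurable F)
    {H : ℝ≥0∞} (hH : ∀ x, F x ≤ H) :
    ∫⁻ x, F x * 𝒦.maxTrunc φ x ≤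
      10 * (2 * B + ν + 1) * (H * ∫⁻ x, F x) ^ (1 / 2 : ℝ) * eLpNorm φ 2 volume := by
  obtain ⟨ψ, hψ, hψB, hle⟩ := 𝒦.exists_enorm_sum_op_le hd hν hlo hhi hB hφm hφ₁ hφ₂
  have h1 := D.lintegral_mul_maximalSq_le hF hH hψ.1
  have h2 := D.lintegral_mul_maximalSq_le hF hH hφ₂.1
  have hm1 := D.measurable_maximalSq ψ
  have hm2 := D.measurable_maximalSq φ
  set R := (H * ∫⁻ x, F x) ^ (1 / 2 : ℝ)
  set N := eLpNorm φ 2 volume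
  calc ∫⁻ x, F x * 𝒦.maxTrunc φ x
      ≤ ∫⁻ x, (2 * (F x * D.maximalSq ψ x) + 2 * (B + ν + 1) * (F x * D.maximalSq φ x)) := by
        refine lintegral_mono fun x => ?_
        calc F x * 𝒦.maxTrunc φ x
            ≤ F x * (2 * (D.maximalSq ψ x + (B + ν + 1) * D.maximalSq φ x)) := by
              gcongr
              exact iSup₂_le fun a b => hle a b x
          _ = _ := by ring
    _ = 2 * (∫⁻ x, F x * D.maximalSq ψ x) +
        2 * (B + ν + 1) * ∫⁻ x, F x * D.maximalSq φ x := by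
        rw [lintegral_add_left (by fun_prop), lintegral_const_mul _ (by fun_prop),
          lintegral_const_mul _ (by fun_prop)]
    _ ≤ 2 * (5 * R * (B * N)) + 2 * (B + ν + 1) * (5 * R * N) := by
        gcongr
        exact h1.trans (by gcongr)
    _ = _ := by ring

end DyadicKernel

theorem exists_Icc_eq_filter (s : Finset ℤ) (hs : (s : Set ℤ).OrdConnected) (p : ℤ → Prop)
    [DecidablePred p] (hp : ∀ i j k, i ≤ j → j ≤ k → p i → p k → p j) :
    ∃ a b, s.filter p = Finset.Icc a b ∧ (a ≤ b → p a) := by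
  rcases (s.filter p).eq_empty_or_nonempty with h | h
  · exact ⟨1, 0, by simp [h], by simp⟩
  · have h1 := Finset.mem_filter.1 ((s.filter p).min'_mem h)
    have h2 := Finset.mem_filter.1 ((s.filter p).max'_mem h)
    refine ⟨(s.filter p).min' h, (s.filter p).max' h, ?_, fun _ => h1.2⟩
    ext k
    rw [Finset.mem_Icc]
    refine ⟨fun hk => ⟨Finset.min'_le _ _ hk, Finset.le_max' _ _ hk⟩, fun ⟨h3, h4⟩ => ?_⟩
    exact Finset.mem_filter.2 ⟨hs.out h1.1 h2.1 ⟨h3, h4⟩, hp _ _ _ h3 h4 h1.2 h2.2⟩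

namespace DyadicGrid

variable {d : ℕ} (D : DyadicGrid d)

/-- The stopping levels of the Calderón–Zygmund decomposition of `w` at height `h`, restricted to
the levels between `p` and `b`. -/
theorem exists_stopping_level (w : (Fin d → ℝ) → ℝ≥0∞) (h : ℝ≥0∞) {p b : ℤ} (hpb : p ≤ b) :
    ∃ j : (Fin d → ℝ) → ℤ, (∀ x, p ≤ j x) ∧ (∀ x, j x ≤ b) ∧
      (∀ x k, j x < k → k ≤ b → D.avg k w x ≤ h) ∧ (∀ x, p < j x → h < D.avg (j x) w x) ∧
      ∀ x y, D.cell (j x) x = D.cell (j x) y → j x = j y := by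
  classical
  set s : (Fin d → ℝ) → Finset ℤ := fun x =>
    insert p ((Finset.Icc p b).filter fun k => h < D.avg k w x) with hs
  have hne : ∀ x, (s x).Nonempty := fun x => Finset.insert_nonempty _ _
  have hmem : ∀ x k, k ∈ s x ↔ k = p ∨ (p ≤ k ∧ k ≤ b) ∧ h < D.avg k w x := by
    intro x k
    simp [hs]
  have hj : ∀ x, (s x).max' (hne x) = p ∨ (p ≤ (s x).max' (hne x) ∧ (s x).max' (hne x) ≤ b) ∧
      h < D.avg ((s x).max' (hne x)) w x := fun x => (hmem x _).1 ((s x).max'_mem (hne x))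
  have hp : ∀ x, p ≤ (s x).max' (hne x) := fun x => Finset.le_max' _ _ ((hmem x p).2 (Or.inl rfl))
  refine ⟨fun x => (s x).max' (hne x), hp, fun x => ?_, fun x k hk hkb => ?_, fun x hx => ?_,
    fun x y e => ?_⟩
  · rcases hj x with h1 | h1
    · exact h1.trans_le hpb
    · exact h1.1.2
  · by_contra! hlt
    have := Finset.le_max' _ _ ((hmem x k).2 (Or.inr ⟨⟨(hp x).trans hk.le, hkb⟩, hlt⟩))
    exact absurd hk (not_lt.2 this)
  · rcases hj x with h1 | h1
    · exact absurd h1 hx.ne'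
    · exact h1.2
  · have h1 : (s x).max' (hne x) ≤ (s y).max' (hne y) := by
      refine Finset.le_max' _ _ ((hmem y _).2 ?_)
      rcases hj x with h1 | h1
      · exact Or.inl h1
      · refine Or.inr ⟨h1.1, ?_⟩
        rw [← D.avg_congr le_rfl e]
        exact h1.2
    refine le_antisymm h1 ?_
    refine Finset.le_max' _ _ ((hmem x _).2 ?_)
    rcases hj y with h2 | h2
    · exact Or.inl h2
    · refine Or.inr ⟨h2.1, ?_⟩
      rw [D.avg_congr h1 e]
      exact h2.2

end DyadicGrid

namespace DyadicKernel

variable {d : ℕ} {D : DyadicGrid d} {m n : ℕ} (𝒦 : DyadicKernel D m n)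

theorem exists_norm_op_le (k : ℤ) {f : (Fin d → ℝ) → ℂ} (hf : Integrable f) :
    ∃ C : ℝ, ∀ x, ‖𝒦.op k f x‖ ≤ C := by
  have hfin : (D.vol k)⁻¹ * ∫⁻ y, ‖f y‖ₑ ≠ ∞ :=
    ENNReal.mul_ne_top (ENNReal.inv_ne_top.2 (D.vol_ne_zero k)) hf.2.ne
  refine ⟨((D.vol k)⁻¹ * ∫⁻ y, ‖f y‖ₑ).toReal, fun x => ?_⟩
  rw [← toReal_enorm]
  refine ENNReal.toReal_mono hfin ((𝒦.enorm_op_le k f x).trans ?_)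
  exact mul_le_mul_right (setLIntegral_le_lintegral _ _) _

theorem integrable_mul_op_self (k : ℤ) {f g : (Fin d → ℝ) → ℂ} (hf : Integrable f)
    (hg : Integrable g) : Integrable fun x => g x * 𝒦.op k f x := by
  obtain ⟨C, hC⟩ := 𝒦.exists_norm_op_le k hf
  exact hg.mul_bdd (c := C) (𝒦.measurable_op k f).aestronglyMeasurable
    (Eventually.of_forall hC)

theorem op_add (k : ℤ) {f g : (Fin d → ℝ) → ℂ} (hf : Integrable f) (hg : Integrable g)
    (x : Fin d → ℝ) : 𝒦.op k (f + g) x = 𝒦.op k f x + 𝒦.op k g x := by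
  have hm : AEStronglyMeasurable (𝒦.K k x) :=
    ((𝒦.measurable_K k).comp measurable_prodMk_left).aestronglyMeasurable
  have hb : ∀ y, ‖𝒦.K k x y‖ ≤ (D.vol k)⁻¹.toReal := fun y => by
    rw [← toReal_enorm]
    exact ENNReal.toReal_mono (ENNReal.inv_ne_top.2 (D.vol_ne_zero k)) (𝒦.bound k x y)
  have hi : ∀ {f : (Fin d → ℝ) → ℂ}, Integrable f → Integrable fun y => 𝒦.K k x y * f y :=
    fun hf => hf.bdd_mul hm (Eventually.of_forall hb)
  simp only [op, Pi.add_apply, mul_add]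
  exact integral_add (hi hf) (hi hg)

/-- Duality for a sum of transposed operators with cut-offs. -/
theorem enorm_integral_sum_transpose_le (s : Finset ℤ) {f φ : (Fin d → ℝ) → ℂ}
    (hf : Integrable f) (hφ : Integrable φ) {I : ℤ → Set (Fin d → ℝ)}
    (hI : ∀ k, MeasurableSet (I k)) {U : (Fin d → ℝ) → ℝ≥0∞}
    (hU : ∀ x, ‖∑ k ∈ s, (I k).indicator (𝒦.op k φ) x‖ₑ ≤ U x) :
    ‖∫ y, (∑ k ∈ s, 𝒦.transpose.op k ((I k).indicator f) y) * φ y‖ₑ ≤ ∫⁻ x, ‖f x‖ₑ * U x := by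
  have hfI : ∀ k, Integrable ((I k).indicator f) := fun k => hf.indicator (hI k)
  have e : ∫ y, (∑ k ∈ s, 𝒦.transpose.op k ((I k).indicator f) y) * φ y =
      ∫ x, f x * ∑ k ∈ s, (I k).indicator (𝒦.op k φ) x := by
    have e1 : ∀ x, f x * ∑ k ∈ s, (I k).indicator (𝒦.op k φ) x =
        ∑ k ∈ s, (I k).indicator f x * 𝒦.op k φ x := by
      intro x
      rw [Finset.mul_sum]
      refine Finset.sum_congr rfl fun k _ => ?_
      by_cases hx : x ∈ I k <;> simp [hx]
    simp only [e1, Finset.sum_mul]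
    rw [integral_finsetSum _ fun k _ => 𝒦.integrable_mul_op_self k hφ (hfI k),
      integral_finsetSum]
    · exact Finset.sum_congr rfl fun k _ => (𝒦.integral_mul_op k hφ (hfI k)).symm
    · intro k _
      simpa only [mul_comm] using 𝒦.transpose.integrable_mul_op_self k (hfI k) hφ
  rw [e]
  refine (enorm_integral_le_lintegral_enorm _).trans (lintegral_mono fun x => ?_)
  rw [enorm_mul]
  gcongr
  exact hU x

/-- Truncation sets: the levels at which a given point is kept form an interval. -/
structure IsTruncation (I : ℤ → Set (Fin d → ℝ)) : Prop where
  measurableSet : ∀ k, MeasurableSet (I k)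
  ordConnected : ∀ x i j k, i ≤ j → j ≤ k → x ∈ I i → x ∈ I k → x ∈ I j

/-- The maximal truncations over cubes of level greater than `i + m`. -/
noncomputable def maxTruncAbove (i : ℤ) (φ : (Fin d → ℝ) → ℂ) (x : Fin d → ℝ) : ℝ≥0∞ :=
  ⨆ a, ⨆ b, ⨆ _ : i + m < a, ‖∑ k ∈ Finset.Icc a b, 𝒦.op k φ x‖ₑ

theorem maxTruncAbove_le (i : ℤ) (φ : (Fin d → ℝ) → ℂ) (x : Fin d → ℝ) :
    𝒦.maxTruncAbove i φ x ≤ 𝒦.maxTrunc φ x :=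
  iSup₂_le fun a b => iSup_le fun _ => 𝒦.enorm_sum_le_maxTrunc a b φ x

theorem maxTruncAbove_congr {i : ℤ} (φ : (Fin d → ℝ) → ℂ) {x y : Fin d → ℝ}
    (e : D.cell i x = D.cell i y) : 𝒦.maxTruncAbove i φ x = 𝒦.maxTruncAbove i φ y := by
  unfold maxTruncAbove
  refine iSup_congr fun a => iSup_congr fun b => iSup_congr fun h => ?_
  congr 1
  refine Finset.sum_congr rfl fun k hk => 𝒦.op_congr ?_ e φ
  have := (Finset.mem_Icc.1 hk).1
  omega

theorem enorm_sum_indicator_le_maxTrunc {I : ℤ → Set (Fin d → ℝ)} (hI : IsTruncation I)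
    (a b : ℤ) (φ : (Fin d → ℝ) → ℂ) (x : Fin d → ℝ) :
    ‖∑ k ∈ Finset.Icc a b, (I k).indicator (𝒦.op k φ) x‖ₑ ≤ 𝒦.maxTrunc φ x := by
  classical
  have e : ∑ k ∈ Finset.Icc a b, (I k).indicator (𝒦.op k φ) x =
      ∑ k ∈ (Finset.Icc a b).filter (x ∈ I ·), 𝒦.op k φ x := by
    rw [Finset.sum_filter]
    exact Finset.sum_congr rfl fun k _ => Set.indicator_apply _ _ _
  obtain ⟨a', b', h, -⟩ := exists_Icc_eq_filter (Finset.Icc a b)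
    (by rw [Finset.coe_Icc]; exact Set.ordConnected_Icc) (x ∈ I ·) (hI.ordConnected x)
  rw [e, h]
  exact 𝒦.enorm_sum_le_maxTrunc a' b' φ x

end DyadicKernel

theorem sq_mul_measure_lt_le {α : Type*} [MeasurableSpace α] {μ : Measure α} {G : α → ℂ}
    (hG : Measurable G) (t : ℝ≥0∞) :
    t ^ 2 * μ {x | t < ‖G x‖ₑ} ≤ eLpNorm G 2 μ ^ 2 := by
  rw [eLpNorm_two_sq]
  refine le_trans ?_ (mul_meas_ge_le_lintegral (hG.enorm.pow_const 2) (t ^ 2))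
  gcongr
  exact fun hx => pow_le_pow_left' hx.le 2

namespace DyadicKernel

variable {d : ℕ} {D : DyadicGrid d} {m n : ℕ} (𝒦 : DyadicKernel D m n)

theorem lintegral_mul_maxTruncAbove_le {w : (Fin d → ℝ) → ℝ≥0∞} (hw : Measurable w)
    {h : ℝ≥0∞} {p b : ℤ} {j : (Fin d → ℝ) → ℤ} (hj₁ : ∀ x, p ≤ j x)
    (hj₃ : ∀ x k, j x < k → k ≤ b → D.avg k w x ≤ h)
    (hj₅ : ∀ x y, D.cell (j x) x = D.cell (j x) y → j x = j y) (φ : (Fin d → ℝ) → ℂ) :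
    ∃ F : (Fin d → ℝ) → ℝ≥0∞, Measurable F ∧ (∀ x, F x ≤ 2 ^ d * h) ∧
      ∫⁻ x, F x ≤ ∫⁻ x, w x ∧
      ∫⁻ x, w x * {x | j x < b}.indicator (fun x => 𝒦.maxTruncAbove (j x) φ x) x ≤
        ∫⁻ x, F x * 𝒦.maxTrunc φ x := by
  classical
  set χ : ℤ → (Fin d → ℝ) → ℝ≥0∞ := fun i x => if j x = i then 1 else 0 with hχ
  have hχc : ∀ i x y, D.cell i x = D.cell i y → χ i x = χ i y := by
    have : ∀ i x y, D.cell i x = D.cell i y → j x = i → j y = i := by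
      rintro i x y e rfl
      exact (hj₅ x y e).symm
    intro i x y e
    have h2 : j x = i ↔ j y = i := ⟨this i x y e, this i y x e.symm⟩
    simp only [hχ, h2]
  have hχm : ∀ i, Measurable (χ i) := fun i => D.measurable_of_const i (hχc i)
  have havg : ∀ i, Measurable (D.avg i w) := fun i => D.measurable_avg i w
  have hsum : ∀ (x : Fin d → ℝ) (g : ℤ → ℝ≥0∞), ∑ i ∈ Finset.Ico p b, χ i x * g i =
      if j x < b then g (j x) else 0 := by
    intro x g
    simp only [hχ, ite_mul, one_mul, zero_mul, Finset.sum_ite_eq, Finset.mem_Ico, hj₁ x, true_and]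
  have hMm : ∀ i, Measurable (𝒦.maxTruncAbove i φ) := fun i =>
    D.measurable_of_const i fun x y e => 𝒦.maxTruncAbove_congr φ e
  refine ⟨fun x => ∑ i ∈ Finset.Ico p b, χ i x * D.avg i w x, by fun_prop, fun x => ?_, ?_, ?_⟩
  · refine (hsum x fun i => D.avg i w x).trans_le ?_
    split_ifs with hx
    · exact (D.avg_le_avg_succ _ w x).trans
        (mul_le_mul_right (hj₃ x _ (lt_add_one _) (Int.add_one_le_iff.2 hx)) _)
    · exact zero_le
  · rw [lintegral_finsetSum _ fun i _ => by fun_prop]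
    simp_rw [fun i => D.lintegral_mul_avg i hw (hχc i)]
    rw [← lintegral_finsetSum _ fun i _ => by fun_prop]
    refine lintegral_mono fun x => ?_
    rw [hsum x fun _ => w x]
    split_ifs
    · exact le_rfl
    · exact zero_le
  · have e1 : ∀ x, w x * {x | j x < b}.indicator (fun x => 𝒦.maxTruncAbove (j x) φ x) x =
        ∑ i ∈ Finset.Ico p b, (χ i x * 𝒦.maxTruncAbove i φ x) * w x := by
      intro x
      simp only [mul_assoc]
      rw [hsum x fun i => 𝒦.maxTruncAbove i φ x * w x]
      by_cases hx : j x < b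
      · simp [hx, mul_comm]
      · simp [hx]
    simp_rw [e1]
    rw [lintegral_finsetSum _ fun i _ => by have := hMm i; fun_prop]
    have e2 : ∀ i, ∫⁻ x, (χ i x * 𝒦.maxTruncAbove i φ x) * w x =
        ∫⁻ x, (χ i x * 𝒦.maxTruncAbove i φ x) * D.avg i w x := fun i =>
      (D.lintegral_mul_avg i hw fun x y e => by
        rw [hχc i x y e, 𝒦.maxTruncAbove_congr φ e]).symm
    simp_rw [e2]
    rw [← lintegral_finsetSum _ fun i _ => by have := hMm i; fun_prop]
    refine lintegral_mono fun x => ?_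
    rw [Finset.sum_mul]
    refine Finset.sum_le_sum fun i _ => ?_
    rw [mul_right_comm]
    gcongr
    exact 𝒦.maxTruncAbove_le i φ x

theorem exists_norm_sum_op_le (s : Finset ℤ) {f : ℤ → (Fin d → ℝ) → ℂ}
    (hf : ∀ k, Integrable (f k)) : ∃ C : ℝ, ∀ x, ‖∑ k ∈ s, 𝒦.op k (f k) x‖ ≤ C := by
  choose C hC using fun k => 𝒦.exists_norm_op_le k (hf k)
  exact ⟨∑ k ∈ s, C k, fun x => norm_sum_le_of_le _ fun k _ => hC k x⟩

/-- The part of the adjoint that sees only averages over the stopping cubes. -/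
theorem eLpNorm_sum_stopped_le (hd : 1 ≤ d) {ν : ℕ} (hν : 𝒦.Sparse ν) {B : ℝ≥0∞}
    {lo hi : ℕ → ℤ} (hlo : Tendsto lo atTop atBot) (hhi : Tendsto hi atTop atTop)
    (hB : 𝒦.IsL2Bounded B lo hi) {I : ℤ → Set (Fin d → ℝ)} (hI : IsTruncation I)
    {f : (Fin d → ℝ) → ℂ} (hfm : Measurable f) (hf : Integrable f)
    {h : ℝ≥0∞} {p a b : ℤ} {j : (Fin d → ℝ) → ℤ} (hjm : Measurable j) (hj₁ : ∀ x, p ≤ j x)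
    (hj₃ : ∀ x k, j x < k → k ≤ b → D.avg k (fun y => ‖f y‖ₑ) x ≤ h)
    (hj₅ : ∀ x y, D.cell (j x) x = D.cell (j x) y → j x = j y) :
    eLpNorm (fun y => ∑ k ∈ Finset.Icc a b,
        𝒦.transpose.op k ((I k ∩ {x | j x + m < k}).indicator f) y) 2 volume ≤
      10 * (2 * B + ν + 1) * (2 ^ d * h * ∫⁻ x, ‖f x‖ₑ) ^ (1 / 2 : ℝ) := by
  classical
  have hIm : ∀ k, MeasurableSet (I k ∩ {x | j x + m < k}) := fun k =>
    (hI.measurableSet k).inter (measurableSet_lt (hjm.add_const _) measurable_const)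
  obtain ⟨M, hM⟩ := 𝒦.transpose.exists_norm_sum_op_le (Finset.Icc a b)
    fun k => hf.indicator (hIm k)
  refine eLpNorm_two_le_of_dual
    (Finset.measurable_sum _ fun k _ => 𝒦.transpose.measurable_op k _) hM
    fun φ hφm hφ₁ hφ₂ => ?_
  have hU : ∀ x, ‖∑ k ∈ Finset.Icc a b,
      (I k ∩ {x | j x + m < k}).indicator (𝒦.op k φ) x‖ₑ ≤
        {x | j x < b}.indicator (fun x => 𝒦.maxTruncAbove (j x) φ x) x := by
    intro x
    have e : ∑ k ∈ Finset.Icc a b, (I k ∩ {x | j x + m < k}).indicator (𝒦.op k φ) x =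
        ∑ k ∈ (Finset.Icc a b).filter (fun k => x ∈ I k ∧ j x + m < k), 𝒦.op k φ x := by
      rw [Finset.sum_filter]
      exact Finset.sum_congr rfl fun k _ => Set.indicator_apply _ _ _
    obtain ⟨a', b', hab, ha'⟩ := exists_Icc_eq_filter (Finset.Icc a b)
      (by rw [Finset.coe_Icc]; exact Set.ordConnected_Icc) (fun k => x ∈ I k ∧ j x + m < k)
      (fun i j k h1 h2 h3 h4 => ⟨hI.ordConnected x i j k h1 h2 h3.1 h4.1, h3.2.trans_le h1⟩)
    rw [e, hab]
    by_cases hle : a' ≤ b'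
    · have hmem : a' ∈ (Finset.Icc a b).filter (fun k => x ∈ I k ∧ j x + m < k) := by
        rw [hab]; exact Finset.left_mem_Icc.2 hle
      have h1 := (Finset.mem_Icc.1 (Finset.mem_filter.1 hmem).1).2
      have h2 := (ha' hle).2
      have h3 : x ∈ {x | j x < b} := by
        show j x < b
        omega
      rw [Set.indicator_of_mem h3]
      exact le_iSup₂_of_le a' b' (le_iSup_of_le h2 le_rfl)
    · rw [Finset.Icc_eq_empty hle]
      simp
  obtain ⟨F, hFm, hFb, hFi, hFle⟩ :=
    𝒦.lintegral_mul_maxTruncAbove_le hfm.enorm hj₁ hj₃ hj₅ φ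
  refine (𝒦.enorm_integral_sum_transpose_le (Finset.Icc a b) hf
    (memLp_one_iff_integrable.1 hφ₁) hIm hU).trans (hFle.trans ?_)
  refine (𝒦.lintegral_mul_maxTrunc_le hd hν hlo hhi hB hφm hφ₁ hφ₂ hFm hFb).trans ?_
  gcongr

open Classical in
/-- The part of the adjoint in which the cubes are comparable to stopping cubes. -/
theorem lintegral_sum_avg_comparable_le {ν : ℕ} (hν : 𝒦.Sparse ν) {w : (Fin d → ℝ) → ℝ≥0∞}
    (hw : Measurable w) {j : (Fin d → ℝ) → ℤ} (hjm : Measurable j) (s : Finset ℤ) :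
    ∫⁻ y, ∑ k ∈ s.filter (· ∈ 𝒦.active),
      D.avg k ({x | j x < k ∧ k ≤ j x + m}.indicator w) y ≤ ν * ∫⁻ x, w x := by
  have hm : ∀ k : ℤ, MeasurableSet {x | j x < k ∧ k ≤ j x + m} := fun k =>
    (measurableSet_lt hjm measurable_const).inter
      (measurableSet_le measurable_const (hjm.add_const _))
  rw [lintegral_finsetSum _ fun k _ => D.measurable_avg k _]
  simp_rw [fun k => D.lintegral_avg k (hw.indicator (hm k))]
  rw [← lintegral_finsetSum _ fun k _ => hw.indicator (hm k), ← lintegral_const_mul _ hw]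
  refine lintegral_mono fun x => ?_
  simp only [Set.indicator_apply, Set.mem_ofPred_eq]
  rw [← Finset.sum_filter, Finset.sum_const, nsmul_eq_mul]
  gcongr
  refine (Finset.card_le_card fun k hk => ?_).trans (hν (j x))
  simp only [Finset.mem_filter, Finset.mem_Icc] at hk ⊢
  exact ⟨⟨by omega, hk.2.2⟩, hk.1.2⟩

/-- The weak type `(1, 1)` inequality for the adjoint of a linearized maximal truncation, summed
over finitely many scales. -/
theorem mul_volume_sum_transpose_le (hd : 1 ≤ d) {ν : ℕ} (hν : 𝒦.Sparse ν) (hν₁ : 1 ≤ ν)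
    {B : ℝ≥0∞} (hB₁ : 1 ≤ B) (hB_top : B ≠ ∞)
    {lo hi : ℕ → ℤ} (hlo : Tendsto lo atTop atBot) (hhi : Tendsto hi atTop atTop)
    (hB : 𝒦.IsL2Bounded B lo hi) {I : ℤ → Set (Fin d → ℝ)} (hI : IsTruncation I)
    {f : (Fin d → ℝ) → ℂ} (hfm : Measurable f) (hf : Integrable f) (a b : ℤ)
    {t : ℝ≥0∞} (ht : t ≠ 0) (ht' : t ≠ ∞) :
    t * volume {y | t < ‖∑ k ∈ Finset.Icc a b, 𝒦.transpose.op k ((I k).indicator f) y‖ₑ} ≤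
      6403 * 2 ^ d * (ν * B) * ∫⁻ x, ‖f x‖ₑ := by
  classical
  rcases lt_or_ge b a with hab | hab
  · simp [Finset.Icc_eq_empty (not_le.2 hab)]
  set w : (Fin d → ℝ) → ℝ≥0∞ := fun y => ‖f y‖ₑ with hw
  have hwm : Measurable w := hfm.enorm
  have hνB0 : (ν * B : ℝ≥0∞) ≠ 0 := by
    refine mul_ne_zero ?_ (one_pos.trans_le hB₁).ne'
    exact_mod_cast (by omega : ν ≠ 0)
  have hνB1 : (ν * B : ℝ≥0∞) ≠ ∞ := ENNReal.mul_ne_top (by simp) hB_top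
  set h : ℝ≥0∞ := t / (ν * B) with hh
  obtain ⟨j, hj₁, -, hj₃, hj₄, hj₅⟩ := D.exists_stopping_level w h (p := a - m - 1) (b := b)
    (by omega)
  have hjm : Measurable j := by
    refine measurable_to_countable' fun i => ?_
    refine measurableSet_setOfPred.2 (D.measurable_of_const i fun x y e => propext ?_)
    simp only [Set.mem_singleton_iff]
    have : ∀ x y, D.cell i x = D.cell i y → j x = i → j y = i := by
      rintro x y e rfl
      exact (hj₅ x y e).symm
    exact ⟨this x y e, this y x e.symm⟩
  set G : (Fin d → ℝ) → ℂ := fun y => ∑ k ∈ Finset.Icc a b,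
        𝒦.transpose.op k ((I k ∩ {x | j x + m < k}).indicator f) y with hG
  have hGm : Measurable G := Finset.measurable_sum _ fun k _ => 𝒦.transpose.measurable_op k _
  set E : (Fin d → ℝ) → ℝ≥0∞ := fun y => ∑ k ∈ (Finset.Icc a b).filter (· ∈ 𝒦.active),
      D.avg k ({x | j x < k ∧ k ≤ j x + m}.indicator w) y with hE
  have hEm : Measurable E := Finset.measurable_sum _ fun k _ => D.measurable_avg k _
  have hpt : ∀ y, D.maximal w y ≤ h →
      ‖∑ k ∈ Finset.Icc a b, 𝒦.transpose.op k ((I k).indicator f) y‖ₑ ≤ ‖G y‖ₑ + E y := by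
    intro y hy
    have hlt : ∀ k : ℤ, MeasurableSet {x | j x + m < k} := fun k =>
      measurableSet_lt (hjm.add_const _) measurable_const
    have e : ∑ k ∈ Finset.Icc a b, 𝒦.transpose.op k ((I k).indicator f) y = G y +
        ∑ k ∈ Finset.Icc a b,
          𝒦.transpose.op k ((I k ∩ {x | j x + m < k}ᶜ).indicator f) y := by
      rw [hG, ← Finset.sum_add_distrib]
      refine Finset.sum_congr rfl fun k _ => ?_
      rw [← 𝒦.transpose.op_add k (hf.indicator ((hI.measurableSet k).inter (hlt k)))
        (hf.indicator ((hI.measurableSet k).inter (hlt k).compl))]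
      congr 1
      ext x
      by_cases h1 : x ∈ I k <;> by_cases h2 : j x + m < k <;> simp [h1, h2]
    rw [e]
    refine (enorm_add_le _ _).trans (add_le_add le_rfl ?_)
    have e2 : ∑ k ∈ Finset.Icc a b,
        𝒦.transpose.op k ((I k ∩ {x | j x + m < k}ᶜ).indicator f) y =
        ∑ k ∈ (Finset.Icc a b).filter (· ∈ 𝒦.active),
          𝒦.transpose.op k ((I k ∩ {x | j x + m < k}ᶜ).indicator f) y := by
      refine (Finset.sum_filter_of_ne fun k _ hk => ?_).symm
      by_contra h
      rw [← 𝒦.active_transpose] at h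
      exact hk (𝒦.transpose.op_eq_zero h _ y)
    rw [e2]
    refine (enorm_sum_le _ _).trans (Finset.sum_le_sum fun k hk => ?_)
    have hk := (Finset.mem_Icc.1 (Finset.mem_filter.1 hk).1).1
    refine (𝒦.transpose.enorm_op_le k _ y).trans (D.avg_mono fun x hx => ?_)
    by_cases h1 : x ∈ I k
    swap
    · simp [h1]
    by_cases h2 : j x + m < k
    · simp [h2]
    by_cases h3 : j x < k
    · simp [h1, h2, h3, not_lt.1 h2, hw]
    · have h4 := hj₄ x (by omega)
      have hxy : D.cell (j x) x = D.cell (j x) y :=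
        D.cell_eq_of_le (not_lt.1 h3) (D.mem_cell_iff.1 hx)
      rw [D.avg_congr le_rfl hxy] at h4
      exact absurd ((D.avg_le_maximal _ _ _).trans hy) (not_le.2 h4)
  have hsub : {y | t < ‖∑ k ∈ Finset.Icc a b, 𝒦.transpose.op k ((I k).indicator f) y‖ₑ} ⊆
      {y | h < D.maximal w y} ∪ ({y | t / 2 < ‖G y‖ₑ} ∪ {y | t / 2 ≤ E y}) := by
    intro y hy
    by_contra hy'
    simp only [Set.mem_union, Set.mem_ofPred_eq, not_or, not_lt, not_le] at hy'
    refine absurd (hpt y hy'.1) (not_le.2 (lt_of_le_of_lt ?_ hy))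
    exact (add_le_add hy'.2.1 hy'.2.2.le).trans (ENNReal.add_halves t).le
  set A := ∫⁻ x, ‖f x‖ₑ with hA
  have b1 : t * volume {y | h < D.maximal w y} ≤ ν * B * A := by
    have h1 := D.mul_volume_maximal_le hwm h
    calc t * volume {y | h < D.maximal w y} = ν * B * (h * volume {y | h < D.maximal w y}) := by
          rw [← mul_assoc, hh, ENNReal.mul_div_cancel hνB0 hνB1]
      _ ≤ _ := by gcongr
  have b2 : t * volume {y | t / 2 ≤ E y} ≤ 2 * (ν * A) := by
    have h1 := (mul_meas_ge_le_lintegral hEm (t / 2)).trans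
      (𝒦.lintegral_sum_avg_comparable_le hν hwm hjm _)
    calc t * volume {y | t / 2 ≤ E y} = 2 * (t / 2 * volume {y | t / 2 ≤ E y}) := by
          rw [← mul_assoc, ENNReal.mul_div_cancel (by simp) (by simp)]
      _ ≤ _ := by gcongr
  have hlin : 2 * B + ν + 1 ≤ 4 * (ν * B) := by
    have h1 : (1 : ℝ≥0∞) ≤ ν := by exact_mod_cast hν₁
    calc 2 * B + ν + 1 ≤ 2 * (ν * B) + ν * B + ν * B := by
          gcongr
          · exact le_mul_of_one_le_left zero_le h1
          · exact le_mul_of_one_le_right zero_le hB₁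
          · exact one_le_mul h1 hB₁
      _ = _ := by ring
  have b3 : t * volume {y | t / 2 < ‖G y‖ₑ} ≤ 6400 * 2 ^ d * (ν * B) * A := by
    have h1 := sq_mul_measure_lt_le (μ := volume) hGm (t / 2)
    have h2 := pow_le_pow_left'
      (𝒦.eLpNorm_sum_stopped_le hd hν hlo hhi hB hI hfm hf (a := a) hjm hj₁ hj₃ hj₅) 2
    have h3 : (t / 2) ^ 2 * volume {y | t / 2 < ‖G y‖ₑ} ≤
        (10 * (4 * (ν * B))) ^ 2 * (2 ^ d * h * A) := by
      refine h1.trans (h2.trans ?_)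
      rw [mul_pow _ ((2 ^ d * h * A) ^ (1 / 2 : ℝ)), ← ENNReal.rpow_natCast (_ ^ (1 / 2 : ℝ)),
        ← ENNReal.rpow_mul]
      norm_num only [Nat.cast_ofNat, one_div, ENNReal.rpow_one]
      gcongr
    have ht2 : t * t⁻¹ = 1 := ENNReal.mul_inv_cancel ht ht'
    calc t * volume {y | t / 2 < ‖G y‖ₑ}
        = t * t⁻¹ * (t * (2 * 2⁻¹) * (2 * 2⁻¹) * volume {y | t / 2 < ‖G y‖ₑ}) := by
          rw [ht2, ENNReal.mul_inv_cancel (by simp) (by simp)]; simp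
      _ = 4 * t⁻¹ * ((t / 2) ^ 2 * volume {y | t / 2 < ‖G y‖ₑ}) := by
          rw [div_eq_mul_inv]; ring
      _ ≤ 4 * t⁻¹ * ((10 * (4 * (ν * B))) ^ 2 * (2 ^ d * h * A)) := by gcongr
      _ = 6400 * 2 ^ d * (ν * B) * A * (t * t⁻¹) * ((ν * B) * (ν * B)⁻¹) := by
          rw [hh, div_eq_mul_inv]; ring
      _ = _ := by rw [ht2, ENNReal.mul_inv_cancel hνB0 hνB1, mul_one, mul_one]
  calc t * volume {y | t < ‖∑ k ∈ Finset.Icc a b, 𝒦.transpose.op k ((I k).indicator f) y‖ₑ}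
      ≤ t * (volume {y | h < D.maximal w y} +
          (volume {y | t / 2 < ‖G y‖ₑ} + volume {y | t / 2 ≤ E y})) := by
        gcongr
        exact (measure_mono hsub).trans ((measure_union_le _ _).trans
          (add_le_add le_rfl (measure_union_le _ _)))
    _ ≤ ν * B * A + (6400 * 2 ^ d * (ν * B) * A + 2 * (ν * A)) := by
        rw [mul_add, mul_add]
        exact add_le_add b1 (add_le_add b3 b2)
    _ ≤ 2 ^ d * (ν * B) * A + (6400 * 2 ^ d * (ν * B) * A + 2 * (2 ^ d * (ν * B) * A)) := by
        have h2 : (1 : ℝ≥0∞) ≤ 2 ^ d := one_le_pow₀ (by norm_num)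
        have h3 : ν * B ≤ 2 ^ d * (ν * B) := le_mul_of_one_le_left zero_le h2
        have h4 : (ν : ℝ≥0∞) ≤ 2 ^ d * (ν * B) := (le_mul_of_one_le_right zero_le hB₁).trans h3
        exact add_le_add (mul_le_mul_left h3 A)
          (add_le_add le_rfl (mul_le_mul_right (mul_le_mul_left h4 A) 2))
    _ = _ := by ring

end DyadicKernel

namespace DyadicKernel

variable {d : ℕ} {D : DyadicGrid d} {m n : ℕ} (𝒦 : DyadicKernel D m n)

/-- The `L²` bound for the adjoint, applied to functions dominated by an indicator. -/
theorem eLpNorm_sum_transpose_le (hd : 1 ≤ d) {ν : ℕ} (hν : 𝒦.Sparse ν) {B : ℝ≥0∞}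
    {lo hi : ℕ → ℤ} (hlo : Tendsto lo atTop atBot) (hhi : Tendsto hi atTop atTop)
    (hB : 𝒦.IsL2Bounded B lo hi) {I : ℤ → Set (Fin d → ℝ)} (hI : IsTruncation I)
    {f : (Fin d → ℝ) → ℂ} (hfm : Measurable f) (hf : Integrable f)
    {H : ℝ≥0∞} (hH : ∀ x, ‖f x‖ₑ ≤ H) (a b : ℤ) :
    eLpNorm (fun y => ∑ k ∈ Finset.Icc a b, 𝒦.transpose.op k ((I k).indicator f) y) 2 volume ≤
      10 * (2 * B + ν + 1) * (H * ∫⁻ x, ‖f x‖ₑ) ^ (1 / 2 : ℝ) := by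
  obtain ⟨M, hM⟩ := 𝒦.transpose.exists_norm_sum_op_le (Finset.Icc a b)
    fun k => hf.indicator (hI.measurableSet k)
  refine eLpNorm_two_le_of_dual
    (Finset.measurable_sum _ fun k _ => 𝒦.transpose.measurable_op k _) hM
    fun φ hφm hφ₁ hφ₂ => ?_
  exact (𝒦.enorm_integral_sum_transpose_le (Finset.Icc a b) hf
    (memLp_one_iff_integrable.1 hφ₁) hI.measurableSet
    (𝒦.enorm_sum_indicator_le_maxTrunc hI a b φ)).trans
    (𝒦.lintegral_mul_maxTrunc_le hd hν hlo hhi hB hφm hφ₁ hφ₂ hfm.enorm hH)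

/-- The mean of the small scales of the adjoint over a cube. -/
theorem inv_vol_mul_enorm_integral_small_le (hd : 1 ≤ d) {ν : ℕ} (hν : 𝒦.Sparse ν) {B : ℝ≥0∞}
    {lo hi : ℕ → ℤ} (hlo : Tendsto lo atTop atBot) (hhi : Tendsto hi atTop atTop)
    (hB : 𝒦.IsL2Bounded B lo hi) {I : ℤ → Set (Fin d → ℝ)} (hI : IsTruncation I)
    {f : (Fin d → ℝ) → ℂ} (hfm : Measurable f) (hf : Integrable f)
    {H : ℝ≥0∞} {E : Set (Fin d → ℝ)} (hE : MeasurableSet E)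
    (hH : ∀ x, ‖f x‖ₑ ≤ E.indicator (fun _ => H) x) (a p : ℤ) (y : Fin d → ℝ) :
    (D.vol p)⁻¹ * ‖∫ z in (D.cell p y).toSet,
        ∑ k ∈ Finset.Icc a p, 𝒦.transpose.op k ((I k).indicator f) z‖ₑ ≤
      10 * (2 * B + ν + 1) * (H * D.maximalSq (E.indicator 1) y) := by
  set P := (D.cell p y).toSet with hP
  have hPm : MeasurableSet P := D.measurableSet_toSet _
  have hPvol : volume P = D.vol p := D.volume_cell p y
  have h0 := D.vol_ne_zero p
  have h1 := D.vol_ne_top p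
  set φ : (Fin d → ℝ) → ℂ := P.indicator 1 with hφ
  have hφm : Measurable φ := measurable_one.indicator hPm
  have hφp : ∀ q, MemLp φ q := fun q =>
    memLp_indicator_const q hPm 1 (Or.inr (by rw [hPvol]; exact h1))
  have hφN : eLpNorm φ 2 volume ^ 2 = D.vol p := by
    rw [eLpNorm_two_sq, ← hPvol, ← lintegral_indicator_one hPm]
    refine lintegral_congr fun x => ?_
    by_cases hx : x ∈ P <;> simp [hφ, hx]
  have e : ∫ z in P, ∑ k ∈ Finset.Icc a p, 𝒦.transpose.op k ((I k).indicator f) z =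
      ∫ z, (∑ k ∈ Finset.Icc a p, 𝒦.transpose.op k ((I k).indicator (P.indicator f)) z) * φ z := by
    rw [← integral_indicator hPm]
    refine integral_congr_ae (Eventually.of_forall fun z => ?_)
    by_cases hz : z ∈ P
    · simp only [hφ, hz, Set.indicator_of_mem, Pi.one_apply, mul_one]
      refine Finset.sum_congr rfl fun k hk => ?_
      rw [Set.indicator_indicator, Set.inter_comm, ← Set.indicator_indicator]
      exact (𝒦.transpose.op_indicator (Finset.mem_Icc.1 hk).2 hz _).symm
    · simp [hφ, hz]
  set F : (Fin d → ℝ) → ℝ≥0∞ := fun x => ‖P.indicator f x‖ₑ with hF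
  have hFm : Measurable F := (hfm.indicator hPm).enorm
  have hFH : ∀ x, F x ≤ (P ∩ E).indicator (fun _ => H) x := by
    intro x
    by_cases hx : x ∈ P
    · have := hH x
      by_cases hx' : x ∈ E <;> simpa [hF, hx, hx'] using this
    · simp [hF, hx]
  have hFi : ∫⁻ x, F x ≤ H * volume (P ∩ E) := by
    refine (lintegral_mono hFH).trans ?_
    rw [lintegral_indicator_const (hPm.inter hE)]
  have hFb : ∀ x, F x ≤ H := fun x => (hFH x).trans (Set.indicator_le_self' (by simp) x)
  have hdual := (𝒦.enorm_integral_sum_transpose_le (Finset.Icc a p) (hf.indicator hPm)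
    (memLp_one_iff_integrable.1 (hφp 1)) hI.measurableSet
    (𝒦.enorm_sum_indicator_le_maxTrunc hI a p φ)).trans
    (𝒦.lintegral_mul_maxTrunc_le hd hν hlo hhi hB hφm (hφp 1) (hφp 2) hFm hFb)
  rw [← e] at hdual
  have hkey : (D.vol p)⁻¹ * ((H * ∫⁻ x, F x) ^ (1 / 2 : ℝ) * eLpNorm φ 2 volume) ≤
      H * D.maximalSq (E.indicator 1) y := by
    refine le_of_sq_le_sq ?_
    rw [mul_pow, mul_pow, hφN, ← ENNReal.rpow_natCast (_ ^ (1 / 2 : ℝ)), ← ENNReal.rpow_mul,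
      mul_pow, D.maximalSq_sq]
    norm_num only [Nat.cast_ofNat, one_div, ENNReal.rpow_one]
    calc (D.vol p)⁻¹ ^ 2 * ((H * ∫⁻ x, F x) * D.vol p)
        ≤ (D.vol p)⁻¹ ^ 2 * ((H * (H * volume (P ∩ E))) * D.vol p) := by gcongr
      _ = H ^ 2 * ((D.vol p)⁻¹ * volume (P ∩ E)) * ((D.vol p)⁻¹ * D.vol p) := by ring
      _ = H ^ 2 * D.avg p (fun z => ‖E.indicator (1 : (Fin d → ℝ) → ℂ) z‖ₑ ^ 2) y := by
        rw [ENNReal.inv_mul_cancel h0 h1, mul_one, DyadicGrid.avg,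
          ← lintegral_indicator_one (hPm.inter hE), ← lintegral_indicator hPm]
        congr 3
        ext z
        by_cases hz : z ∈ P <;> by_cases hz' : z ∈ E <;> simp [hz, hz']
      _ ≤ _ := by
        gcongr
        exact D.avg_le_maximal p _ y
  calc (D.vol p)⁻¹ * ‖∫ z in P, ∑ k ∈ Finset.Icc a p, 𝒦.transpose.op k ((I k).indicator f) z‖ₑ
      ≤ (D.vol p)⁻¹ *
        (10 * (2 * B + ν + 1) * (H * ∫⁻ x, F x) ^ (1 / 2 : ℝ) * eLpNorm φ 2 volume) := by gcongr
    _ = 10 * (2 * B + ν + 1) *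
        ((D.vol p)⁻¹ * ((H * ∫⁻ x, F x) ^ (1 / 2 : ℝ) * eLpNorm φ 2 volume)) := by ring
    _ ≤ _ := by gcongr

/-- Cotlar's inequality for the adjoint, applied to functions dominated by an indicator. -/
theorem enorm_sum_transpose_le (hd : 1 ≤ d) {ν : ℕ} (hν : 𝒦.Sparse ν) {B : ℝ≥0∞}
    {lo hi : ℕ → ℤ} (hlo : Tendsto lo atTop atBot) (hhi : Tendsto hi atTop atTop)
    (hB : 𝒦.IsL2Bounded B lo hi) {I : ℤ → Set (Fin d → ℝ)} (hI : IsTruncation I)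
    {f : (Fin d → ℝ) → ℂ} (hfm : Measurable f) (hf : Integrable f)
    {H : ℝ≥0∞} {E : Set (Fin d → ℝ)} (hE : MeasurableSet E)
    (hH : ∀ x, ‖f x‖ₑ ≤ E.indicator (fun _ => H) x) {a₀ p b : ℤ} (h₁ : a₀ ≤ p + 1)
    (h₂ : p + n ≤ b) (y : Fin d → ℝ) :
    ‖∑ k ∈ Finset.Icc (p + n + 1) b, 𝒦.transpose.op k ((I k).indicator f) y‖ₑ ≤
      D.maximalSq (fun y => ∑ k ∈ Finset.Icc a₀ b, 𝒦.transpose.op k ((I k).indicator f) y) y +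
        (n + 10 * (2 * B + ν + 1)) * (H * D.maximalSq (E.indicator 1) y) := by
  set τ : ℤ → (Fin d → ℝ) → ℂ := fun k => 𝒦.transpose.op k ((I k).indicator f) with hτ
  have hτi : ∀ k, Integrable (τ k) := fun k =>
    𝒦.transpose.integrable_op k (hf.indicator (hI.measurableSet k))
  set G : (Fin d → ℝ) → ℂ := fun y => ∑ k ∈ Finset.Icc a₀ b, τ k y with hG
  set P := (D.cell p y).toSet with hP
  have hPm : MeasurableSet P := D.measurableSet_toSet _
  have h0 := D.vol_ne_zero p
  have h1 := D.vol_ne_top p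
  set A := ∑ k ∈ Finset.Icc (p + n + 1) b, τ k y with hA
  set S : (Fin d → ℝ) → ℂ := fun z => ∑ k ∈ Finset.Icc a₀ p, τ k z with hS
  set R : (Fin d → ℝ) → ℂ := fun z => ∑ k ∈ Finset.Icc (p + 1) (p + n), τ k z with hR
  have hint : ∀ s : Finset ℤ, Integrable (fun z => ∑ k ∈ s, τ k z) (volume.restrict P) := fun s =>
    (integrable_finsetSum s fun k _ => hτi k).restrict
  have hpt : ∀ z ∈ P, G z = A + (S z + R z) := by
    intro z hz
    have e2 : ∑ k ∈ Finset.Icc (p + n + 1) b, τ k z = A :=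
      Finset.sum_congr rfl fun k hk => 𝒦.transpose.op_congr
        (by have := (Finset.mem_Icc.1 hk).1; omega) (D.mem_cell_iff.1 hz) _
    rw [hG, hS, hR]
    simp only
    rw [← sum_Icc_add_sum_Icc _ h₁ (by omega : p ≤ b),
      ← sum_Icc_add_sum_Icc (fun k => τ k z) (by omega : p + 1 ≤ p + n + 1) h₂, e2]
    ring
  have hRle : ∀ z ∈ P, ‖R z‖ₑ ≤ n * (H * D.maximalSq (E.indicator 1) y) := by
    intro z hz
    refine (enorm_sum_le _ _).trans ?_
    refine (Finset.sum_le_card_nsmul _ _ (H * D.maximalSq (E.indicator 1) y) fun k hk => ?_).trans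
      (by simp)
    refine (𝒦.transpose.enorm_op_le k _ z).trans ?_
    rw [D.avg_congr (l := p) (by have := (Finset.mem_Icc.1 hk).1; omega) (D.mem_cell_iff.1 hz)]
    refine le_trans ?_ (mul_le_mul_right (D.avg_le_maximalSq k
      (measurable_one.indicator hE).aestronglyMeasurable y) H)
    have e3 : H * D.avg k (fun z => ‖E.indicator (1 : (Fin d → ℝ) → ℂ) z‖ₑ) y =
        D.avg k (fun z => H * ‖E.indicator (1 : (Fin d → ℝ) → ℂ) z‖ₑ) y := by
      unfold DyadicGrid.avg
      rw [mul_left_comm, lintegral_const_mul _ (measurable_one.indicator hE).enorm]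
    rw [e3]
    refine D.avg_mono fun x _ => ?_
    refine le_trans ?_ ((hH x).trans (le_of_eq ?_))
    · by_cases hx : x ∈ I k <;> simp [hx]
    · by_cases hx : x ∈ E <;> simp [hx]
  have hmain : ((D.vol p).toReal : ℂ) * A =
      (∫ z in P, G z) - (∫ z in P, S z) - ∫ z in P, R z := by
    have hconst : Integrable (fun _ : Fin d → ℝ => A) (volume.restrict P) :=
      integrableOn_const (by rw [hP, D.volume_cell]; exact h1)
    have hreal : volume.real P = (D.vol p).toReal := by rw [measureReal_def, hP, D.volume_cell]
    have hSi : Integrable S (volume.restrict P) := hint _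
    have hRi : Integrable R (volume.restrict P) := hint _
    have hSR : Integrable (fun z => S z + R z) (volume.restrict P) := hSi.add hRi
    rw [setIntegral_congr_fun hPm hpt, integral_add hconst hSR, integral_add hSi hRi, setIntegral_const, hreal, Complex.real_smul]
    ring
  have hRint : (D.vol p)⁻¹ * ‖∫ z in P, R z‖ₑ ≤ n * (H * D.maximalSq (E.indicator 1) y) := by
    have h3 : ‖∫ z in P, R z‖ₑ ≤ D.vol p * (n * (H * D.maximalSq (E.indicator 1) y)) := by
      refine (enorm_integral_le_lintegral_enorm _).trans ?_
      refine (setLIntegral_mono' hPm hRle).trans ?_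
      rw [setLIntegral_const, hP, D.volume_cell, mul_comm]
    refine (mul_le_mul_right h3 _).trans ?_
    rw [← mul_assoc, ENNReal.inv_mul_cancel h0 h1, one_mul]
  have hnorm : ‖((D.vol p).toReal : ℂ)‖ₑ = D.vol p := by
    rw [← ofReal_norm, Complex.norm_real, Real.norm_of_nonneg ENNReal.toReal_nonneg,
      ENNReal.ofReal_toReal h1]
  have hGm : Measurable G := Finset.measurable_sum _ fun k _ => 𝒦.transpose.measurable_op k _
  calc ‖A‖ₑ = (D.vol p)⁻¹ * ‖((D.vol p).toReal : ℂ) * A‖ₑ := by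
        rw [enorm_mul, hnorm, ← mul_assoc, ENNReal.inv_mul_cancel h0 h1, one_mul]
    _ ≤ (D.vol p)⁻¹ * (‖∫ z in P, G z‖ₑ + ‖∫ z in P, S z‖ₑ + ‖∫ z in P, R z‖ₑ) := by
        rw [hmain]
        gcongr
        exact enorm_sub_le.trans (add_le_add enorm_sub_le le_rfl)
    _ = (D.vol p)⁻¹ * ‖∫ z in P, G z‖ₑ + (D.vol p)⁻¹ * ‖∫ z in P, S z‖ₑ +
          (D.vol p)⁻¹ * ‖∫ z in P, R z‖ₑ := by rw [mul_add, mul_add]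
    _ ≤ D.maximalSq G y + 10 * (2 * B + ν + 1) * (H * D.maximalSq (E.indicator 1) y) +
          n * (H * D.maximalSq (E.indicator 1) y) := by
        refine add_le_add (add_le_add ?_ ?_) hRint
        · exact (inv_vol_mul_enorm_integral_le p y).trans
            (D.avg_le_maximalSq p hGm.aestronglyMeasurable y)
        · exact 𝒦.inv_vol_mul_enorm_integral_small_le hd hν hlo hhi hB hI hfm hf hE hH a₀ p y
    _ = _ := by ring

theorem volume_maximalSq_le {ψ : (Fin d → ℝ) → ℂ}
    (hψ : AEStronglyMeasurable ψ) {t : ℝ≥0∞} (ht : t ≠ 0) (ht' : t ≠ ∞) :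
    volume {x | t < D.maximalSq ψ x} ≤ (t ^ 2)⁻¹ * eLpNorm ψ 2 volume ^ 2 := by
  have h := D.sq_mul_volume_maximalSq_le hψ t
  rw [← ENNReal.div_eq_inv_mul]
  rw [ENNReal.le_div_iff_mul_le (Or.inl (pow_ne_zero _ ht)) (Or.inl (ENNReal.pow_ne_top ht')),
    mul_comm]
  exact h

/-- The maximal partial sums, at small scales, of the adjoint of a function that is bounded and
supported on a small set. -/
theorem exists_volume_sum_transpose_le (hd : 1 ≤ d) {ν : ℕ} (hν : 𝒦.Sparse ν) {B : ℝ≥0∞}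
    (hB_top : B ≠ ∞)
    {lo hi : ℕ → ℤ} (hlo : Tendsto lo atTop atBot) (hhi : Tendsto hi atTop atTop)
    (hB : 𝒦.IsL2Bounded B lo hi) {I : ℤ → Set (Fin d → ℝ)} (hI : IsTruncation I)
    {H : ℝ≥0∞} (hH_top : H ≠ ∞) {t : ℝ≥0∞} (ht : t ≠ 0) (ht' : t ≠ ∞) (b : ℤ) :
    ∃ C : ℝ≥0∞, C ≠ ∞ ∧ ∀ (f : (Fin d → ℝ) → ℂ) (E : Set (Fin d → ℝ)), Measurable f →
      Integrable f → MeasurableSet E → (∀ x, ‖f x‖ₑ ≤ E.indicator (fun _ => H) x) →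
      volume {y | ∃ a ≤ b, t < ‖∑ k ∈ Finset.Icc a b,
        𝒦.transpose.op k ((I k).indicator f) y‖ₑ} ≤ C * volume E := by
  have hc : (10 * (2 * B + ν + 1) : ℝ≥0∞) ≠ ∞ := by finiteness
  set c : ℝ≥0∞ := 10 * (2 * B + ν + 1) with hc'
  have hK : ((n + c) * H + 1 : ℝ≥0∞) ≠ ∞ := by finiteness
  have hK0 : ((n + c) * H + 1 : ℝ≥0∞) ≠ 0 := by simp
  set K : ℝ≥0∞ := (n + c) * H + 1 with hK'
  have ht2 : t / 2 ≠ 0 := by simp [ht]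
  have ht2' : t / 2 ≠ ∞ := ENNReal.div_ne_top ht' (by simp)
  have ht3 : t / 2 / K ≠ 0 := by simp [ht, hK]
  have ht3' : t / 2 / K ≠ ∞ := ENNReal.div_ne_top ht2' hK0
  refine ⟨((t / 2) ^ 2)⁻¹ * (c ^ 2 * (H * H)) + ((t / 2 / K) ^ 2)⁻¹, ?_, ?_⟩
  · have i1 : ((t / 2) ^ 2)⁻¹ ≠ ∞ := ENNReal.inv_ne_top.2 (pow_ne_zero _ ht2)
    have i2 : ((t / 2 / K) ^ 2)⁻¹ ≠ ∞ := ENNReal.inv_ne_top.2 (pow_ne_zero _ ht3)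
    finiteness
  intro f E hfm hf hE hH
  have hHb : ∀ x, ‖f x‖ₑ ≤ H := fun x => (hH x).trans (Set.indicator_le_self' (by simp) x)
  have hfi : ∫⁻ x, ‖f x‖ₑ ≤ H * volume E :=
    (lintegral_mono hH).trans (by rw [lintegral_indicator_const hE])
  set τ : ℤ → (Fin d → ℝ) → ℂ := fun k => 𝒦.transpose.op k ((I k).indicator f) with hτ
  have hstep : ∀ N : ℕ, volume {y | ∃ a ≤ b, b - N ≤ a ∧ t < ‖∑ k ∈ Finset.Icc a b, τ k y‖ₑ} ≤
      (((t / 2) ^ 2)⁻¹ * (c ^ 2 * (H * H)) + ((t / 2 / K) ^ 2)⁻¹) * volume E := by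
    intro N
    set G : (Fin d → ℝ) → ℂ := fun y => ∑ k ∈ Finset.Icc (b - N - n) b, τ k y with hG
    have hGm : Measurable G := Finset.measurable_sum _ fun k _ => 𝒦.transpose.measurable_op k _
    have hG2 : eLpNorm G 2 volume ^ 2 ≤ c ^ 2 * (H * H) * volume E := by
      have := pow_le_pow_left' (𝒦.eLpNorm_sum_transpose_le hd hν hlo hhi hB hI hfm hf hHb
        (b - N - n) b) 2
      refine this.trans ?_
      rw [mul_pow, ← ENNReal.rpow_natCast (_ ^ (1 / 2 : ℝ)), ← ENNReal.rpow_mul]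
      norm_num only [Nat.cast_ofNat, one_div, ENNReal.rpow_one]
      rw [mul_assoc (c ^ 2), mul_assoc H]
      gcongr
    have hE2 : eLpNorm (E.indicator (1 : (Fin d → ℝ) → ℂ)) 2 volume ^ 2 = volume E := by
      rw [eLpNorm_two_sq, ← lintegral_indicator_one hE]
      refine lintegral_congr fun x => ?_
      by_cases hx : x ∈ E <;> simp [hx]
    have hsub : {y | ∃ a ≤ b, b - N ≤ a ∧ t < ‖∑ k ∈ Finset.Icc a b, τ k y‖ₑ} ⊆
        {y | t / 2 < D.maximalSq G y} ∪ {y | t / 2 / K < D.maximalSq (E.indicator 1) y} := by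
      rintro y ⟨a, hab, haN, hy⟩
      by_contra hy'
      simp only [Set.mem_union, Set.mem_ofPred_eq, not_or, not_lt] at hy'
      have h1 := 𝒦.enorm_sum_transpose_le hd hν hlo hhi hB hI hfm hf hE hH
        (a₀ := b - N - n) (p := a - n - 1) (b := b) (by omega) (by omega) y
      rw [show a - n - 1 + (n : ℤ) + 1 = a by ring] at h1
      refine absurd hy (not_lt.2 (h1.trans ?_))
      calc _ ≤ t / 2 + K * (t / 2 / K) := by
            refine add_le_add hy'.1 ?_
            rw [← mul_assoc]
            exact mul_le_mul le_self_add hy'.2 zero_le zero_le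
        _ = t := by rw [ENNReal.mul_div_cancel hK0 hK, ENNReal.add_halves]
    calc _ ≤ _ := (measure_mono hsub).trans (measure_union_le _ _)
      _ ≤ ((t / 2) ^ 2)⁻¹ * (c ^ 2 * (H * H) * volume E) +
          ((t / 2 / K) ^ 2)⁻¹ * volume E := by
        refine add_le_add ?_ ?_
        · exact (volume_maximalSq_le hGm.aestronglyMeasurable ht2 ht2').trans
            (mul_le_mul_right hG2 _)
        · rw [← hE2]
          exact volume_maximalSq_le
            (measurable_one.indicator hE).aestronglyMeasurable ht3 ht3'
      _ = _ := by ring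
  have hU : {y | ∃ a ≤ b, t < ‖∑ k ∈ Finset.Icc a b, τ k y‖ₑ} =
      ⋃ N : ℕ, {y | ∃ a ≤ b, b - N ≤ a ∧ t < ‖∑ k ∈ Finset.Icc a b, τ k y‖ₑ} := by
    ext y
    simp only [Set.mem_ofPred_eq, Set.mem_iUnion]
    constructor
    · rintro ⟨a, hab, hy⟩
      exact ⟨(b - a).toNat, a, hab, by omega, hy⟩
    · rintro ⟨_, a, hab, -, hy⟩
      exact ⟨a, hab, hy⟩
  have hmono : Monotone fun N : ℕ =>
      {y | ∃ a ≤ b, b - N ≤ a ∧ t < ‖∑ k ∈ Finset.Icc a b, τ k y‖ₑ} := by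
    rintro N N' hN y ⟨a, hab, haN, hy⟩
    exact ⟨a, hab, by omega, hy⟩
  rw [hU, hmono.measure_iUnion]
  exact iSup_le hstep

end DyadicKernel

namespace DyadicKernel

variable {d : ℕ} {D : DyadicGrid d} {m n : ℕ} (𝒦 : DyadicKernel D m n)

/-- The large scales of the adjoint converge absolutely. -/
theorem exists_tendsto_sum_large (hd : 1 ≤ d) {f : (Fin d → ℝ) → ℂ}
    (hf : Integrable f) (I : ℤ → Set (Fin d → ℝ)) {hi : ℕ → ℤ} (hhi : Tendsto hi atTop atTop)
    (b : ℤ) (y : Fin d → ℝ) :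
    ∃ l, Tendsto (fun N => ∑ k ∈ Finset.Icc (b + 1) (hi N),
      𝒦.op k ((I k).indicator f) y) atTop (𝓝 l) := by
  set τ : ℤ → ℂ := fun k => 𝒦.op k ((I k).indicator f) y with hτ
  have hre : ∀ (q : ℕ) {M : Type} [AddCommMonoid M] (F : ℤ → M),
      ∑ k ∈ Finset.Icc (b + 1) (b + q), F k = ∑ i ∈ Finset.range q, F (b + 1 + i) := by
    intro q M _ F
    symm
    refine Finset.sum_nbij (fun i : ℕ => b + 1 + (i : ℤ)) ?_ ?_ ?_ fun _ _ => rfl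
    · intro i hi
      have := Finset.mem_range.1 hi
      rw [Finset.mem_Icc]
      omega
    · intro i _ j _ h
      simpa using h
    · intro k hk
      have := Finset.mem_Icc.1 (Finset.mem_coe.1 hk)
      refine ⟨(k - b - 1).toNat, Finset.mem_coe.2 (Finset.mem_range.2 (by omega)), ?_⟩
      simp only
      omega
  have hle : ∀ k, ‖τ k‖ₑ ≤ (D.vol k)⁻¹ * ∫⁻ x, ‖f x‖ₑ := by
    intro k
    refine (𝒦.enorm_op_le k _ y).trans (mul_le_mul_right ?_ _)
    refine (setLIntegral_le_lintegral _ _).trans (lintegral_mono fun x => ?_)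
    by_cases hx : x ∈ I k <;> simp [hx]
  have hsum : Summable fun i : ℕ => τ (b + 1 + i) := by
    refine Summable.of_norm ?_
    have hfin : ∑' i : ℕ, ‖τ (b + 1 + i)‖ₑ ≠ ∞ := by
      refine ne_top_of_le_ne_top (b := (D.vol b)⁻¹ * ∫⁻ x, ‖f x‖ₑ)
        (ENNReal.mul_ne_top (ENNReal.inv_ne_top.2 (D.vol_ne_zero b)) hf.2.ne) ?_
      refine ENNReal.tsum_le_of_sum_range_le fun q => ?_
      rw [← hre q fun k => ‖τ k‖ₑ]
      refine (Finset.sum_le_sum fun k _ => hle k).trans ?_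
      rw [← Finset.sum_mul]
      exact mul_le_mul_left (D.sum_inv_vol_le hd b _) _
    have := ENNReal.summable_toReal hfin
    simpa using this
  refine ⟨∑' i : ℕ, τ (b + 1 + i), ?_⟩
  have h1 : Tendsto (fun N => (hi N - b).toNat) atTop atTop := by
    refine tendsto_atTop.2 fun q => ?_
    filter_upwards [hhi.eventually_ge_atTop (b + q)] with N hN
    omega
  refine (hsum.hasSum.tendsto_sum_nat.comp h1).congr' ?_
  filter_upwards [hhi.eventually_ge_atTop b] with N hN
  simp only [Function.comp]
  rw [← hre _ τ]
  congr 2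
  omega

/-- The series defining the adjoint of a linearized maximal truncation converges almost
everywhere. -/
theorem ae_exists_tendsto_sum_transpose (hd : 1 ≤ d) {ν : ℕ} (hν : 𝒦.Sparse ν) {B : ℝ≥0∞}
    (hB_top : B ≠ ∞)
    {lo hi : ℕ → ℤ} (hlo : Tendsto lo atTop atBot) (hhi : Tendsto hi atTop atTop)
    (hB : 𝒦.IsL2Bounded B lo hi) {I : ℤ → Set (Fin d → ℝ)} (hI : IsTruncation I)
    (hI₀ : ∀ x, ∃ k₀, ∀ k < k₀, x ∉ I k)
    {f : (Fin d → ℝ) → ℂ} (hfm : Measurable f) (hf : Integrable f) {H : ℝ≥0∞} (hH_top : H ≠ ∞)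
    (hH : ∀ x, ‖f x‖ₑ ≤ H) {E : Set (Fin d → ℝ)} (hE : MeasurableSet E) (hE_top : volume E ≠ ∞)
    (hfE : ∀ x ∉ E, f x = 0) :
    ∀ᵐ y, ∃ l, Tendsto (fun N => ∑ k ∈ Finset.Icc (lo N) (hi N),
      𝒦.transpose.op k ((I k).indicator f) y) atTop (𝓝 l) := by
  -- the points at which small scales are kept
  set A : ℕ → Set (Fin d → ℝ) := fun i => E ∩ ⋃ k : ℤ, ⋃ _ : k < -i, I k with hA
  have hAm : ∀ i, MeasurableSet (A i) := fun i =>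
    hE.inter (MeasurableSet.iUnion fun k => MeasurableSet.iUnion fun _ => hI.measurableSet k)
  have hAanti : Antitone A := by
    rintro i i' h x ⟨hx, hx'⟩
    obtain ⟨k, hk, hx'⟩ := Set.mem_iUnion₂.1 hx'
    exact ⟨hx, Set.mem_iUnion₂.2 ⟨k, by omega, hx'⟩⟩
  have hAlim : Tendsto (fun i => volume (A i)) atTop (𝓝 0) := by
    have h := tendsto_measure_iInter_atTop (μ := volume) (s := A)
      (fun i => (hAm i).nullMeasurableSet) hAanti
      ⟨0, ne_top_of_le_ne_top hE_top (measure_mono Set.inter_subset_left)⟩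
    have hempty : ⋂ i, A i = ∅ := by
      refine Set.eq_empty_of_forall_notMem fun x hx => ?_
      obtain ⟨k₀, hk₀⟩ := hI₀ x
      obtain ⟨k, hk, hx'⟩ := Set.mem_iUnion₂.1 (Set.mem_iInter.1 hx (-k₀).toNat).2
      exact hk₀ k (by omega) hx'
    rwa [hempty, measure_empty] at h
  set g : ℕ → (Fin d → ℝ) → ℂ := fun i => (A i).indicator f with hg
  have hbad : ∀ j : ℕ, ∀ᵐ y, ∃ i : ℕ, ∀ a ≤ 0, ‖∑ k ∈ Finset.Icc a 0,
      𝒦.transpose.op k ((I k).indicator (g i)) y‖ₑ ≤ ((j : ℝ≥0∞) + 1)⁻¹ := by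
    intro j
    obtain ⟨C, hC, hCle⟩ := 𝒦.exists_volume_sum_transpose_le hd hν hB_top hlo hhi hB hI hH_top
      (t := ((j : ℝ≥0∞) + 1)⁻¹) (ENNReal.inv_ne_zero.2 (by finiteness)) (by simp) 0
    have hle : ∀ i, volume {y | ∃ a ≤ (0 : ℤ), ((j : ℝ≥0∞) + 1)⁻¹ < ‖∑ k ∈ Finset.Icc a 0,
        𝒦.transpose.op k ((I k).indicator (g i)) y‖ₑ} ≤ C * volume (A i) := by
      intro i
      refine hCle (g i) (A i) (hfm.indicator (hAm i)) (hf.indicator (hAm i)) (hAm i) fun x => ?_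
      by_cases hx : x ∈ A i
      · simpa [hg, hx] using hH x
      · simp [hg, hx]
    have hlim : Tendsto (fun i => C * volume (A i)) atTop (𝓝 0) := by
      simpa using ENNReal.Tendsto.const_mul hAlim (Or.inr hC)
    rw [ae_iff]
    refine le_antisymm (ge_of_tendsto' hlim fun i => (measure_mono fun y hy => ?_).trans (hle i))
      zero_le
    simp only [Set.mem_ofPred_eq, not_exists, not_forall, not_le] at hy
    obtain ⟨a, ha, hy⟩ := hy i
    exact ⟨a, ha, hy⟩
  filter_upwards [ae_all_iff.2 hbad] with y hy
  obtain ⟨l₂, hl₂⟩ := 𝒦.transpose.exists_tendsto_sum_large hd hf I hhi 0 y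
  set c : ℤ → ℂ := fun a => ∑ k ∈ Finset.Icc a 0, 𝒦.transpose.op k ((I k).indicator f) y with hc
  have hcauchy : CauchySeq fun N => c (lo N) := by
    refine Metric.cauchySeq_iff'.2 fun ε hε => ?_
    obtain ⟨j, hj⟩ := exists_nat_one_div_lt (half_pos hε)
    obtain ⟨i, hi⟩ := hy j
    set c' : ℤ → ℂ := fun a => ∑ k ∈ Finset.Icc a 0,
      𝒦.transpose.op k ((I k).indicator (g i)) y with hc'
    have hdiff : ∀ a : ℤ, a ≤ -i → c a - c' a = ∑ k ∈ Finset.Icc (-i : ℤ) 0,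
        (𝒦.transpose.op k ((I k).indicator f) y -
          𝒦.transpose.op k ((I k).indicator (g i)) y) := by
      intro a ha
      rw [hc, hc']
      simp only
      rw [← Finset.sum_sub_distrib, ← sum_Icc_add_sum_Icc _
        (by omega : a ≤ (-i - 1 : ℤ) + 1) (by omega : (-i - 1 : ℤ) ≤ 0), sub_add_cancel]
      refine add_eq_right.2 (Finset.sum_eq_zero fun k hk => ?_)
      rw [sub_eq_zero]
      congr 1
      ext x
      by_cases hx : x ∈ I k
      swap
      · simp [hx]
      simp only [hx, Set.indicator_of_mem, hg]
      by_cases hxE : x ∈ E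
      · rw [Set.indicator_of_mem]
        refine ⟨hxE, Set.mem_iUnion₂.2 ⟨k, ?_, hx⟩⟩
        have := (Finset.mem_Icc.1 hk).2
        omega
      · rw [hfE x hxE, eq_comm, Set.indicator_apply_eq_zero]
        exact fun _ => hfE x hxE
    have hsmall : ∀ a : ℤ, a ≤ -i → ‖c' a‖ < ε / 2 := by
      intro a ha
      refine lt_of_le_of_lt ?_ hj
      have h1 := ENNReal.toReal_mono (by simp) (hi a (by omega))
      rw [toReal_enorm] at h1
      refine h1.trans (le_of_eq ?_)
      rw [ENNReal.toReal_inv, ENNReal.toReal_add (by simp) (by simp)]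
      simp
    obtain ⟨N₀, hN₀⟩ := eventually_atTop.1 (hlo.eventually_le_atBot (-i))
    refine ⟨N₀, fun N hN => ?_⟩
    have h1 := hdiff _ (hN₀ N hN)
    have h2 := hdiff _ (hN₀ N₀ le_rfl)
    rw [dist_eq_norm, show c (lo N) - c (lo N₀) = c' (lo N) - c' (lo N₀) by
      linear_combination h1 - h2]
    have h3 := hsmall _ (hN₀ N hN)
    have h4 := hsmall _ (hN₀ N₀ le_rfl)
    linarith [norm_sub_le (c' (lo N)) (c' (lo N₀))]
  obtain ⟨l₁, hl₁⟩ := cauchySeq_tendsto_of_complete hcauchy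
  refine ⟨l₁ + l₂, (hl₁.add hl₂).congr' ?_⟩
  filter_upwards [hlo.eventually_le_atBot 0, hhi.eventually_ge_atTop 0] with N h1 h2
  exact sum_Icc_add_sum_Icc _ (by omega) h2

end DyadicKernel

namespace DyadicGrid

variable {d : ℕ} {D : DyadicGrid d}

theorem Cube.IsGenHaar.eq_zero {P : D.Cube} {h : (Fin d → ℝ) → ℂ} (hh : P.IsGenHaar h)
    {x : Fin d → ℝ} (hx : x ∉ P.toSet) : h x = 0 := by
  obtain ⟨c, rfl⟩ := hh
  refine Finset.sum_eq_zero fun R hR => ?_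
  rw [Set.indicator_of_notMem fun hx' => hx ((Cube.mem_descendants.1 hR).2 hx'), mul_zero]

theorem Cube.IsGenHaar.congr {P : D.Cube} {h : (Fin d → ℝ) → ℂ} (hh : P.IsGenHaar h)
    {x x' : Fin d → ℝ} (e : D.cell (P.level - 1) x = D.cell (P.level - 1) x') : h x = h x' := by
  classical
  obtain ⟨c, rfl⟩ := hh
  refine Finset.sum_congr rfl fun R hR => ?_
  have hR' : R.level = P.level - 1 := by simpa using (Cube.mem_descendants.1 hR).1
  have : ∀ {x x'}, D.cell (P.level - 1) x = D.cell (P.level - 1) x' → x ∈ R.toSet →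
      x' ∈ R.toSet := by
    intro x x' e hx
    rw [eq_cell_of_mem hx, hR', e]
    exact D.mem_cell _ _
  have h2 : x ∈ R.toSet ↔ x' ∈ R.toSet := ⟨this e, this e.symm⟩
  simp only [Set.indicator_apply, h2, Pi.one_apply]

variable (D) in
/-- A sum over the cubes in a range of scales, all of whose nonzero terms come from cubes that
contain a given point. -/
theorem finsum_cube_eq {ε υ : ℝ} {lo hi : ℤ}
    (h : ∀ k : ℤ, (ε ≤ D.unit * 2 ^ k ∧ D.unit * 2 ^ k ≤ υ) ↔ lo ≤ k ∧ k ≤ hi)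
    (F : D.Cube → ℂ) (x : Fin d → ℝ) (hF : ∀ Q : D.Cube, x ∉ Q.toSet → F Q = 0) :
    ∑ᶠ (Q : D.Cube) (_ : ε ≤ Q.side ∧ Q.side ≤ υ), F Q =
      ∑ k ∈ Finset.Icc lo hi, F (D.cell k x) := by
  classical
  simp only [finsum_eq_if]
  rw [finsum_eq_sum_of_support_subset (s := (Finset.Icc lo hi).image fun k => D.cell k x)]
  · rw [Finset.sum_image fun k _ l _ e => congrArg Cube.level e]
    refine Finset.sum_congr rfl fun k hk => if_pos ?_
    exact (h k).2 (Finset.mem_Icc.1 hk)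
  · intro Q hQ
    simp only [Function.mem_support, ne_eq, ite_eq_right_iff, Classical.not_imp] at hQ
    have hx : x ∈ Q.toSet := by
      by_contra hx
      exact hQ.2 (hF Q hx)
    rw [Finset.mem_coe, Finset.mem_image]
    exact ⟨Q.level, Finset.mem_Icc.2 ((h _).1 hQ.1), (eq_cell_of_mem hx).symm⟩

variable (D) in
/-- The smallest level of a cube of side length at least `2 ^ (-N)`. -/
noncomputable def minLevel (N : ℕ) : ℤ := ⌈-(N : ℝ) - Real.logb 2 D.unit⌉

variable (D) in
/-- The largest level of a cube of side length at most `2 ^ N`. -/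
noncomputable def maxLevel (N : ℕ) : ℤ := ⌊(N : ℝ) - Real.logb 2 D.unit⌋

variable (D) in
theorem logb_side (k : ℤ) : Real.logb 2 (D.unit * 2 ^ k) = Real.logb 2 D.unit + k := by
  have hk : (0 : ℝ) < 2 ^ k := zpow_pos (by norm_num) k
  rw [Real.logb_mul D.unit_pos.ne' hk.ne', ← Real.rpow_intCast,
    Real.logb_rpow (by norm_num) (by norm_num)]

theorem inv_two_pow_le_side_iff (N : ℕ) (k : ℤ) :
    ((2 : ℝ) ^ N)⁻¹ ≤ D.unit * 2 ^ k ↔ D.minLevel N ≤ k := by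
  have hk : 0 < D.unit * 2 ^ k := mul_pos D.unit_pos (zpow_pos (by norm_num) k)
  rw [minLevel, Int.ceil_le, ← Real.logb_le_logb (b := 2) (by norm_num) (by positivity) hk,
    Real.logb_inv, D.logb_side, ← Real.rpow_natCast, Real.logb_rpow (by norm_num) (by norm_num),
    sub_le_iff_le_add']

theorem side_le_two_pow_iff (N : ℕ) (k : ℤ) :
    D.unit * 2 ^ k ≤ 2 ^ N ↔ k ≤ D.maxLevel N := by
  have hk : 0 < D.unit * 2 ^ k := mul_pos D.unit_pos (zpow_pos (by norm_num) k)
  rw [maxLevel, Int.le_floor, ← Real.logb_le_logb (b := 2) (by norm_num) hk (by positivity),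
    D.logb_side, ← Real.rpow_natCast, Real.logb_rpow (by norm_num) (by norm_num), le_sub_iff_add_le']

theorem side_mem_iff (N : ℕ) (k : ℤ) :
    (((2 : ℝ) ^ N)⁻¹ ≤ D.unit * 2 ^ k ∧ D.unit * 2 ^ k ≤ 2 ^ N) ↔
      D.minLevel N ≤ k ∧ k ≤ D.maxLevel N :=
  and_congr (inv_two_pow_le_side_iff N k) (side_le_two_pow_iff N k)

theorem tendsto_minLevel : Tendsto D.minLevel atTop atBot := by
  refine tendsto_ceil_atBot.comp ?_
  exact tendsto_atBot_add_const_right _ _ (tendsto_neg_atTop_atBot.comp tendsto_natCast_atTop_atTop)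

theorem tendsto_maxLevel : Tendsto D.maxLevel atTop atTop := by
  refine tendsto_floor_atTop.comp ?_
  exact tendsto_atTop_add_const_right _ _ tendsto_natCast_atTop_atTop

end DyadicGrid

namespace HaarShift

variable {d : ℕ} {D : DyadicGrid d} {m n : ℕ} (S : HaarShift D m n)

theorem kernel_eq_zero_left {Q : D.Cube} {x : Fin d → ℝ} (hx : x ∉ Q.toSet) (y : Fin d → ℝ) :
    S.kernel Q x y = 0 := by
  refine Finset.sum_eq_zero fun Q' hQ' => Finset.sum_eq_zero fun R' hR' => ?_
  rw [(S.k_haar Q Q' hQ' R' hR').eq_zero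
    fun hx' => hx ((DyadicGrid.Cube.mem_descendants.1 hQ').2 hx'), mul_zero]

theorem kernel_eq_zero_right {Q : D.Cube} (x : Fin d → ℝ) {y : Fin d → ℝ} (hy : y ∉ Q.toSet) :
    S.kernel Q x y = 0 := by
  refine Finset.sum_eq_zero fun Q' hQ' => Finset.sum_eq_zero fun R' hR' => ?_
  rw [(S.h_haar Q Q' hQ' R' hR').eq_zero
    fun hy' => hy ((DyadicGrid.Cube.mem_descendants.1 hR').2 hy'), zero_mul]

theorem norm_kernel_le (Q : D.Cube) (x y : Fin d → ℝ) : ‖S.kernel Q x y‖ ≤ 1 := by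
  by_cases hx : x ∈ Q.toSet
  swap
  · simp [S.kernel_eq_zero_left hx]
  by_cases hy : y ∈ Q.toSet
  swap
  · simp [S.kernel_eq_zero_right x hy]
  obtain ⟨k, hk⟩ : ∃ k, k = Q.level := ⟨_, rfl⟩
  have hxm : D.cell (k - m) x ∈ Q.descendants m := by
    rw [DyadicGrid.eq_cell_of_mem hx, hk]
    exact D.cell_mem_descendants _ m x
  have hym : D.cell (k - n) y ∈ Q.descendants n := by
    rw [DyadicGrid.eq_cell_of_mem hy, hk]
    exact D.cell_mem_descendants _ n y
  have e : S.kernel Q x y = S.h (D.cell (k - m) x) (D.cell (k - n) y) y *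
      S.k (D.cell (k - n) y) (D.cell (k - m) x) x := by
    rw [kernel, Finset.sum_eq_single_of_mem _ hxm, Finset.sum_eq_single_of_mem _ hym]
    · intro R' hR' hne
      rw [(S.h_haar Q _ hxm R' hR').eq_zero fun hy' => hne ?_, zero_mul]
      rw [DyadicGrid.eq_of_mem_descendants hR' hy', hk]
    · intro Q' hQ' hne
      refine Finset.sum_eq_zero fun R' hR' => ?_
      rw [(S.k_haar Q Q' hQ' R' hR').eq_zero fun hx' => hne ?_, mul_zero]
      rw [DyadicGrid.eq_of_mem_descendants hQ' hx', hk]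
  rw [e, norm_mul]
  exact mul_le_one₀ (S.h_le Q _ hxm _ hym y) (norm_nonneg _) (S.k_le Q _ hxm _ hym x)

/-- The kernels of the components of a Haar shift, collected by level. -/
noncomputable def toKernel : DyadicKernel D m n where
  K k x y := S.kernel (D.cell k x) x y / ((D.vol k).toReal : ℂ)
  supp k x y h := by
    rw [S.kernel_eq_zero_right x fun hy => h (D.mem_cell_iff.1 hy).symm, zero_div]
  bound k x y := by
    have h0 := D.vol_ne_zero k
    have h1 := D.vol_ne_top k
    have hpos : 0 < (D.vol k).toReal := ENNReal.toReal_pos h0 h1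
    rw [← ofReal_norm, norm_div, Complex.norm_real, Real.norm_of_nonneg hpos.le]
    calc ENNReal.ofReal (‖S.kernel (D.cell k x) x y‖ / (D.vol k).toReal)
        ≤ ENNReal.ofReal (1 / (D.vol k).toReal) := by
          gcongr
          exact S.norm_kernel_le _ x y
      _ = (D.vol k)⁻¹ := by
          rw [one_div, ENNReal.ofReal_inv_of_pos hpos, ENNReal.ofReal_toReal h1]
  left k x x' y e := by
    rw [D.cell_eq_of_le (by omega) e]
    congr 1
    refine Finset.sum_congr rfl fun Q' hQ' => Finset.sum_congr rfl fun R' hR' => ?_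
    rw [(S.k_haar _ Q' hQ' R' hR').congr]
    rw [(DyadicGrid.Cube.mem_descendants.1 hQ').1]
    exact e
  right k x y y' e := by
    congr 1
    refine Finset.sum_congr rfl fun Q' hQ' => Finset.sum_congr rfl fun R' hR' => ?_
    rw [(S.h_haar _ Q' hQ' R' hR').congr]
    rw [(DyadicGrid.Cube.mem_descendants.1 hR').1]
    exact e

theorem comp_eq_zero {Q : D.Cube} (f : (Fin d → ℝ) → ℂ) {x : Fin d → ℝ} (hx : x ∉ Q.toSet) :
    S.comp Q f x = 0 := by
  refine Finset.sum_eq_zero fun Q' hQ' => Finset.sum_eq_zero fun R' hR' => ?_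
  rw [(S.k_haar Q Q' hQ' R' hR').eq_zero
    fun hx' => hx ((DyadicGrid.Cube.mem_descendants.1 hQ').2 hx'), mul_zero]

theorem comp_cell (k : ℤ) {f : (Fin d → ℝ) → ℂ} (hf : Integrable f) (x : Fin d → ℝ) :
    S.comp (D.cell k x) f x = S.toKernel.op k f x := by
  have hi : ∀ Q' ∈ (D.cell k x).descendants m, ∀ R' ∈ (D.cell k x).descendants n,
      Integrable fun y => f y * S.h Q' R' y := by
    intro Q' hQ' R' hR'
    refine hf.mul_bdd (c := 1) ?_ (Eventually.of_forall (S.h_le _ Q' hQ' R' hR'))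
    exact (D.measurable_of_const (R'.level - 1)
      fun y y' e => (S.h_haar _ Q' hQ' R' hR').congr e).aestronglyMeasurable
  have e : ∀ y, S.toKernel.K k x y * f y = ∑ Q' ∈ (D.cell k x).descendants m,
      ∑ R' ∈ (D.cell k x).descendants n,
        (f y * S.h Q' R' y) * (S.k R' Q' x / ((D.vol k).toReal : ℂ)) := by
    intro y
    simp only [toKernel, kernel, Finset.sum_div, Finset.sum_mul]
    refine Finset.sum_congr rfl fun Q' _ => Finset.sum_congr rfl fun R' _ => ?_
    ring
  unfold DyadicKernel.op
  simp_rw [e]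
  rw [integral_finsetSum _ fun Q' hQ' => integrable_finsetSum _ fun R' hR' =>
    (hi Q' hQ' R' hR').mul_const _]
  refine Finset.sum_congr rfl fun Q' hQ' => ?_
  rw [integral_finsetSum _ fun R' hR' => (hi Q' hQ' R' hR').mul_const _]
  refine Finset.sum_congr rfl fun R' hR' => ?_
  rw [integral_mul_const, DyadicGrid.cube_vol, DyadicGrid.cell_level]
  ring

theorem comp_congr_ae (Q : D.Cube) {f g : (Fin d → ℝ) → ℂ} (h : f =ᵐ[volume] g)
    (x : Fin d → ℝ) : S.comp Q f x = S.comp Q g x := by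
  unfold comp
  refine Finset.sum_congr rfl fun Q' _ => Finset.sum_congr rfl fun R' _ => ?_
  congr 2
  refine integral_congr_ae ?_
  filter_upwards [h] with y hy
  rw [hy]

theorem trunc_eq (N : ℕ) {f φ : (Fin d → ℝ) → ℂ} (h : f =ᵐ[volume] φ) (hφ : Integrable φ)
    (x : Fin d → ℝ) : S.trunc ((2 ^ N)⁻¹) (2 ^ N) f x =
      ∑ k ∈ Finset.Icc (D.minLevel N) (D.maxLevel N), S.toKernel.op k φ x := by
  rw [trunc, D.finsum_cube_eq (DyadicGrid.side_mem_iff N) (fun Q => S.comp Q f x) x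
    fun Q hx => S.comp_eq_zero f hx]
  refine Finset.sum_congr rfl fun k _ => ?_
  rw [S.comp_congr_ae _ h, S.comp_cell k hφ]

theorem isL2Bounded {T : Lp ℂ 2 (volume : Measure (Fin d → ℝ)) →L[ℂ]
    Lp ℂ 2 (volume : Measure (Fin d → ℝ))} (hT : S.DefinesL2Operator T) :
    S.toKernel.IsL2Bounded (ENNReal.ofReal (max 1 ‖T‖)) D.minLevel D.maxLevel := by
  intro φ _ hφ₁ hφ₂
  have hφi : Integrable φ := memLp_one_iff_integrable.1 hφ₁
  refine ⟨T (hφ₂.toLp φ), Lp.memLp _, ?_, fun k z => ?_⟩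
  · rw [← Lp.enorm_def, ← ofReal_norm]
    calc ENNReal.ofReal ‖T (hφ₂.toLp φ)‖
        ≤ ENNReal.ofReal (max 1 ‖T‖ * ‖hφ₂.toLp φ‖) := by
          refine ENNReal.ofReal_le_ofReal ((T.le_opNorm _).trans ?_)
          gcongr
          exact le_max_right _ _
      _ = _ := by
          rw [ENNReal.ofReal_mul (by positivity), ofReal_norm, Lp.enorm_toLp]
  · have hPm : MeasurableSet (D.cell k z).toSet := D.measurableSet_toSet _
    have hP : volume (D.cell k z).toSet ≠ ∞ := by
      rw [D.volume_cell]
      exact D.vol_ne_top k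
    have hae : (indicatorConstLp 2 hPm hP (1 : ℂ) : (Fin d → ℝ) → ℂ) =ᵐ[volume]
      (D.cell k z).toSet.indicator fun _ => 1 := indicatorConstLp_coeFn
    have e : ∀ F : (Fin d → ℝ) → ℂ,
        ∫ x, F x * (indicatorConstLp 2 hPm hP (1 : ℂ) : (Fin d → ℝ) → ℂ) x =
          ∫ x in (D.cell k z).toSet, F x := by
      intro F
      rw [← integral_indicator hPm]
      refine integral_congr_ae ?_
      filter_upwards [hae] with x hx
      rw [hx]
      by_cases h : x ∈ (D.cell k z).toSet <;> simp [h]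
    have h := hT (hφ₂.toLp φ) (indicatorConstLp 2 hPm hP (1 : ℂ))
    simp only [e] at h
    refine h.congr fun N => ?_
    congr 1
    ext x
    exact S.trunc_eq N hφ₂.coeFn_toLp hφi x

theorem le_complexity : m ≤ S.complexity := (le_max_left m n).trans (le_max_left _ _)

theorem sparse_complexity : S.toKernel.Sparse S.complexity := by
  classical
  intro j
  refine (Finset.card_filter_le _ _).trans ?_
  have := S.le_complexity
  simpa using this

theorem exists_comp_ne_zero {k : ℤ} (hk : k ∈ S.toKernel.active) :
    ∃ Q : D.Cube, Q.level = k ∧ S.comp Q ≠ 0 := by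
  obtain ⟨x, y, hxy⟩ := hk
  refine ⟨D.cell k x, rfl, fun h => ?_⟩
  set P := (D.cell (k - n - 1) y).toSet with hP
  have hPm : MeasurableSet P := D.measurableSet_toSet _
  have hPvol : volume P = D.vol (k - n - 1) := D.volume_cell _ _
  have hf : Integrable (P.indicator (1 : (Fin d → ℝ) → ℂ)) := by
    refine (integrable_indicator_iff hPm).2 (integrableOn_const (C := (1 : ℂ)) ?_)
    rw [hPvol]
    exact D.vol_ne_top _
  have h1 : S.toKernel.op k (P.indicator 1) x = 0 := by
    rw [← S.comp_cell k hf, h]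
    rfl
  have h2 : S.toKernel.op k (P.indicator 1) x = (volume.real P : ℂ) * S.toKernel.K k x y := by
    have : ∀ z, S.toKernel.K k x z * P.indicator (1 : (Fin d → ℝ) → ℂ) z =
        P.indicator (fun _ => S.toKernel.K k x y) z := by
      intro z
      by_cases hz : z ∈ P
      · simp only [hz, Set.indicator_of_mem, Pi.one_apply, mul_one]
        exact S.toKernel.right k x z y (D.mem_cell_iff.1 hz)
      · simp [hz]
    unfold DyadicKernel.op
    simp_rw [this]
    rw [integral_indicator hPm, setIntegral_const, Complex.real_smul]
  rw [h2, mul_eq_zero] at h1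
  rcases h1 with h1 | h1
  · rw [measureReal_def, hPvol, Complex.ofReal_eq_zero] at h1
    exact (ENNReal.toReal_pos (D.vol_ne_zero _) (D.vol_ne_top _)).ne' h1
  · exact hxy h1

theorem sparse_one (hS : S.ScalesSeparated) : S.toKernel.Sparse 1 := by
  intro j
  refine Finset.card_le_one.2 fun k hk l hl => ?_
  simp only [Finset.mem_filter, Finset.mem_Icc] at hk hl
  obtain ⟨Q, rfl, hQ⟩ := S.exists_comp_ne_zero hk.2
  obtain ⟨R, rfl, hR⟩ := S.exists_comp_ne_zero hl.2
  have hm := S.le_complexity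
  have h := (hS Q R hQ hR).dvd
  have h0 := Int.eq_zero_of_abs_lt_dvd h (by rw [abs_lt]; constructor <;> omega)
  omega

end HaarShift

namespace Linearization

variable {d : ℕ} {D : DyadicGrid d} {m n : ℕ} (L : Linearization d) (S : HaarShift D m n)

/-- The points at which the cubes of level `k` are kept by a linearization. -/
def keep (D : DyadicGrid d) (k : ℤ) : Set (Fin d → ℝ) :=
  {x | L.eps x ≤ D.unit * 2 ^ k ∧ D.unit * 2 ^ k ≤ L.ups x}

theorem isTruncation_keep : DyadicKernel.IsTruncation (L.keep D) where
  measurableSet k := (measurableSet_le L.measurable_eps measurable_const).inter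
    (measurableSet_le measurable_const L.measurable_ups)
  ordConnected x i j k hij hjk hi hk := by
    have hmono : ∀ {i j : ℤ}, i ≤ j → D.unit * 2 ^ i ≤ D.unit * 2 ^ j := fun h =>
      mul_le_mul_of_nonneg_left (zpow_le_zpow_right₀ (by norm_num) h) D.unit_pos.le
    exact ⟨hi.1.trans (hmono hij), (hmono hjk).trans hk.2⟩

theorem exists_notMem_keep (x : Fin d → ℝ) : ∃ k₀ : ℤ, ∀ k < k₀, x ∉ L.keep D k := by
  obtain ⟨N, hN⟩ := exists_pow_lt_of_lt_one (L.eps_pos x) (by norm_num : (1 / 2 : ℝ) < 1)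
  refine ⟨D.minLevel N, fun k hk hx => absurd ?_ (not_le.2 hk)⟩
  rw [one_div, inv_pow] at hN
  exact (DyadicGrid.inv_two_pow_le_side_iff N k).1 (hN.le.trans hx.1)

theorem compAdjoint_cell (k : ℤ) (g : (Fin d → ℝ) → ℂ) (y : Fin d → ℝ) :
    S.compAdjoint (D.cell k y) g y = S.toKernel.transpose.op k g y := by
  rw [HaarShift.compAdjoint, DyadicKernel.op, ← integral_div,
    ← integral_indicator (D.measurableSet_toSet _)]
  congr 1
  ext x
  by_cases hx : x ∈ (D.cell k y).toSet
  · rw [Set.indicator_of_mem hx]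
    simp only [DyadicKernel.transpose, HaarShift.toKernel]
    rw [D.mem_cell_iff.1 hx, DyadicGrid.cube_vol, DyadicGrid.cell_level]
    ring
  · rw [Set.indicator_of_notMem hx]
    simp only [DyadicKernel.transpose]
    rw [S.toKernel.supp k x y fun e => hx (D.mem_cell_iff.2 e), zero_mul]

theorem adjointPartial_eq (N : ℕ) (f : (Fin d → ℝ) → ℂ) (y : Fin d → ℝ) :
    L.adjointPartial S N f y = ∑ k ∈ Finset.Icc (D.minLevel N) (D.maxLevel N),
      S.toKernel.transpose.op k
        ((L.keep D k).indicator fun x => Complex.exp (Complex.I * L.theta x) * f x) y := by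
  rw [adjointPartial, D.finsum_cube_eq (DyadicGrid.side_mem_iff N)
    (fun Q => S.compAdjoint Q (L.cut Q f) y) y]
  · refine Finset.sum_congr rfl fun k _ => ?_
    rw [compAdjoint_cell]
    rfl
  · intro Q hy
    simp [HaarShift.compAdjoint, S.kernel_eq_zero_right _ hy]

end Linearization

theorem mul_measure_lt_norm_le_of_tendsto {α : Type*} [MeasurableSpace α] {μ : Measure α}
    {F : ℕ → α → ℂ} {G : α → ℂ} (h : ∀ᵐ y ∂μ, Tendsto (fun N => F N y) atTop (𝓝 (G y)))
    {t : ℝ} (ht : 0 < t) {c : ℝ≥0∞}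
    (hF : ∀ N, ENNReal.ofReal t * μ {y | ENNReal.ofReal t < ‖F N y‖ₑ} ≤ c) :
    ENNReal.ofReal t * μ {y | t < ‖G y‖} ≤ c := by
  set A : ℕ → Set α := fun N => {y | ∀ M, N ≤ M → ENNReal.ofReal t < ‖F M y‖ₑ} with hA
  have hmono : Monotone A := fun N N' hN y hy M hM => hy M (hN.trans hM)
  have hle : μ {y | t < ‖G y‖} ≤ μ (⋃ N, A N) := by
    refine measure_mono_ae ?_
    filter_upwards [h] with y hy hyt
    have h1 : ENNReal.ofReal t < ‖G y‖ₑ := by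
      rw [← ofReal_norm]
      exact (ENNReal.ofReal_lt_ofReal_iff (ht.trans hyt)).2 hyt
    obtain ⟨N, hN⟩ := eventually_atTop.1 (hy.enorm.eventually_const_lt h1)
    exact Set.mem_iUnion.2 ⟨N, hN⟩
  refine (mul_le_mul_right hle _).trans ?_
  rw [hmono.measure_iUnion, ENNReal.mul_iSup]
  refine iSup_le fun N => le_trans ?_ (hF N)
  gcongr
  exact fun y hy => hy N le_rfl

namespace Linearization

variable {d : ℕ} {D : DyadicGrid d} {m n : ℕ} (L : Linearization d) (S : HaarShift D m n)
  {T : Lp ℂ 2 (volume : Measure (Fin d → ℝ)) →L[ℂ] Lp ℂ 2 (volume : Measure (Fin d → ℝ))}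

theorem enorm_phase_mul (f : (Fin d → ℝ) → ℂ) (x : Fin d → ℝ) :
    ‖Complex.exp (Complex.I * L.theta x) * f x‖ₑ = ‖f x‖ₑ := by
  rw [enorm_mul, ← ofReal_norm (Complex.exp _), mul_comm Complex.I, Complex.norm_exp_ofReal_mul_I]
  simp

theorem measurable_phase_mul {f : (Fin d → ℝ) → ℂ} (hf : Measurable f) :
    Measurable fun x => Complex.exp (Complex.I * L.theta x) * f x :=
  (Complex.measurable_exp.comp
    ((Complex.measurable_ofReal.comp L.measurable_theta).const_mul _)).mul hf

theorem integrable_phase_mul {f : (Fin d → ℝ) → ℂ} (hfm : Measurable f) (hf : Integrable f) :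
    Integrable fun x => Complex.exp (Complex.I * L.theta x) * f x := by
  refine ⟨(L.measurable_phase_mul hfm).aestronglyMeasurable, ?_⟩
  rw [hasFiniteIntegral_iff_enorm]
  simp_rw [enorm_phase_mul]
  exact hf.2

theorem ae_tendsto_adjoint (hd : 1 ≤ d) (hT : S.DefinesL2Operator T) {f : (Fin d → ℝ) → ℂ}
    (hfm : Measurable f) {M : ℝ} (hM : ∀ x, ‖f x‖ ≤ M) (hfc : HasCompactSupport f)
    (hf : Integrable f) :
    ∀ᵐ y, Tendsto (fun N => L.adjointPartial S N f y) atTop (𝓝 (L.adjoint S f y)) := by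
  have h := S.toKernel.ae_exists_tendsto_sum_transpose hd S.sparse_complexity
    ENNReal.ofReal_ne_top DyadicGrid.tendsto_minLevel DyadicGrid.tendsto_maxLevel
    (S.isL2Bounded hT) (L.isTruncation_keep (D := D)) (L.exists_notMem_keep (D := D)) (L.measurable_phase_mul hfm)
    (L.integrable_phase_mul hfm hf) (H := ENNReal.ofReal M) ENNReal.ofReal_ne_top
    (fun x => by
      rw [enorm_phase_mul, ← ofReal_norm]
      exact ENNReal.ofReal_le_ofReal (hM x))
    (E := tsupport f) (isClosed_tsupport f).measurableSet hfc.isCompact.measure_ne_top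
    (fun x hx => by rw [image_eq_zero_of_notMem_tsupport hx, mul_zero])
  filter_upwards [h] with y hy
  simp_rw [← adjointPartial_eq] at hy
  exact tendsto_nhds_limUnder hy

theorem mul_volume_adjoint_le (hd : 1 ≤ d) (hT : S.DefinesL2Operator T) {f : (Fin d → ℝ) → ℂ}
    (hfm : Measurable f) (hf : Integrable f) {ν : ℕ} (hν : S.toKernel.Sparse ν) (hν₁ : 1 ≤ ν)
    (h : ∀ᵐ y, Tendsto (fun N => L.adjointPartial S N f y) atTop (𝓝 (L.adjoint S f y)))
    {t : ℝ} (ht : 0 < t) :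
    ENNReal.ofReal t * volume {y | t < ‖L.adjoint S f y‖} ≤
      ENNReal.ofReal (6403 * 2 ^ d * max 1 ‖T‖ * ν * ∫ x, ‖f x‖) := by
  refine mul_measure_lt_norm_le_of_tendsto h ht fun N => ?_
  have h1 := S.toKernel.mul_volume_sum_transpose_le hd hν hν₁
    (by rw [← ENNReal.ofReal_one]; exact ENNReal.ofReal_le_ofReal (le_max_left _ _))
    ENNReal.ofReal_ne_top DyadicGrid.tendsto_minLevel DyadicGrid.tendsto_maxLevel
    (S.isL2Bounded hT) (L.isTruncation_keep (D := D)) (L.measurable_phase_mul hfm)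
    (L.integrable_phase_mul hfm hf) (D.minLevel N) (D.maxLevel N)
    (t := ENNReal.ofReal t) (by simpa using ht) ENNReal.ofReal_ne_top
  simp_rw [enorm_phase_mul, ← adjointPartial_eq] at h1
  refine h1.trans (le_of_eq ?_)
  rw [← ofReal_integral_norm_eq_lintegral_enorm hf, ENNReal.ofReal_mul (by positivity),
    ENNReal.ofReal_mul (by positivity), ENNReal.ofReal_mul (by positivity),
    ENNReal.ofReal_mul (by positivity), ENNReal.ofReal_pow (by norm_num)]
  simp only [ENNReal.ofReal_natCast, ENNReal.ofReal_ofNat]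
  ring

end Linearization

end HaarModel

theorem theorem8p3 (d : ℕ) (hd : 1 ≤ d) :
    ∃ C : ℝ, 0 < C ∧
      ∀ (D : HaarModel.DyadicGrid d) (m n : ℕ) (S : HaarModel.HaarShift D m n)
        (T : Lp ℂ 2 (volume : Measure (Fin d → ℝ)) →L[ℂ] Lp ℂ 2 (volume : Measure (Fin d → ℝ))),
        S.DefinesL2Operator T →
        ∀ (L : HaarModel.Linearization d) (f : (Fin d → ℝ) → ℂ),
          Measurable f → (∃ M : ℝ, ∀ x, ‖f x‖ ≤ M) → HasCompactSupport f →
          (∀ᵐ y, Tendsto (fun N : ℕ => L.adjointPartial S N f y) atTop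
            (𝓝 (L.adjoint S f y))) ∧
          (∀ t : ℝ, 0 < t →
            ENNReal.ofReal t * volume {y | t < ‖L.adjoint S f y‖} ≤
              ENNReal.ofReal (C * max 1 ‖T‖ * S.complexity * ∫ x, ‖f x‖)) ∧
          (S.ScalesSeparated → ∀ t : ℝ, 0 < t →
            ENNReal.ofReal t * volume {y | t < ‖L.adjoint S f y‖} ≤
              ENNReal.ofReal (C * max 1 ‖T‖ * ∫ x, ‖f x‖)) := by
  refine ⟨6403 * 2 ^ d, by positivity, ?_⟩
  rintro D m n S T hT L f hfm ⟨M, hM⟩ hfc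
  have hf : Integrable f := by
    rw [← integrableOn_iff_integrable_of_support_subset (subset_tsupport f)]
    exact Measure.integrableOn_of_bounded hfc.isCompact.measure_ne_top
      hfm.aestronglyMeasurable (M := M) (Eventually.of_forall hM)
  have h := L.ae_tendsto_adjoint S hd hT hfm hM hfc hf
  refine ⟨h, fun t ht => ?_, fun hS t ht => ?_⟩
  · exact L.mul_volume_adjoint_le S hd hT hfm hf S.sparse_complexity (le_max_right _ _) h ht
  · simpa using L.mul_volume_adjoint_le S hd hT hfm hf (S.sparse_one hS) le_rfl h ht
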